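/- Let $k\ge 2$ be an even integer, let $\nu\in\mathbb C$ with $\operatorname{Re}\nu>0$, and let $a,x>0$ be real. Let $\zeta(s,\alpha)$ denote the Hurwitz zeta function (the analytic continuation in $s$ of $\sum_{n\ge 0}(n+\alpha)^{-s}$), and let $$K_\nu(z)=\frac{\pi}{2}\,\frac{I_{-\nu}(z)-I_\nu(z)}{\sin \pi\nu},\qquad I_\nu(z)=\sum_{j\ge0}\frac{(z/2)^{\nu+2j}}{j!\,\Gamma(\nu+j+1)},$$ be the modified Bessel function, for $\nu\in\mathbb Z$ understood as the limit in the order. (1) For every real $\theta$ with $0<\theta<1$, $$\Big(\frac{a^2x}{4}\Big)^{\frac{\nu}{2}+k+1}\sum_{n=1}^{\infty}n^{\nu/2}K_\nu(a\sqrt{nx})\sum_{d\mid n}d^k\sin\Big(\frac{2\pi n\theta}{d}\Big)=\frac{(-1)^{k/2}2^k\pi^{k+1}}{4}\,\Gamma(\nu+k+1)\big(\zeta(-k,\theta)-\zeta(-k,1-\theta)\big)$$ $$+\frac{(-1)^{k/2}}{4}(2\pi)^{k+1}\Gamma(\nu+k+1)\sum_{r=1}^{\infty}\sum_{m=0}^{\infty}\left\{\frac{(m+\theta)^k}{\big(1+\frac{16\pi^2r}{a^2x}(m+\theta)\big)^{1+\nu+k}}-\frac{(m+1-\theta)^k}{\big(1+\frac{16\pi^2r}{a^2x}(m+1-\theta)\big)^{1+\nu+k}}\right\},$$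 where the series on the left and the double series on the right converge absolutely. (2) The validity of (1) for all $\theta\in(0,1)$ is equivalent to the validity, for every $q\geq 1$ and every odd primitive Dirichlet character $\chi$ modulo $q$, of $$\Big(\frac{a^2x}{4}\Big)^{\frac{\nu}{2}+k+1}\sum_{n=1}^{\infty}\bar\sigma_{k,\chi}(n)\,n^{\nu/2}K_\nu(a\sqrt{nx})=\frac{k!}{2}\Gamma(\nu+k+1)L(1+k,\chi)-\frac{(-1)^{k/2}i}{2}\,\tau(\chi)\Big(\frac{2\pi}{q}\Big)^{k+1}\sum_{n=1}^{\infty}\sigma_{k,\bar\chi}(n)\frac{\Gamma(\nu+k+1)}{\big(\frac{16\pi^2}{a^2q}\frac nx+1\big)^{\nu+k+1}},$$ with both series absolutely convergent, where $\bar\sigma_{k,\chi}(n)=\sum_{d\mid n}d^k\chi(n/d)$, $\sigma_{k,\bar\chi}(n)=\sum_{d\mid n}d^k\bar\chi(d)$ and $\tau(\chi)=\sum_{h=1}^{q}\chi(h)e^{2\pi i h/q}$. In particular, by (1), the identity in (2) holds for all such $\chi$. -/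

import Mathlib

/-- The modified Bessel function of the first kind,
`I_ν(z) = ∑_{j ≥ 0} (z/2)^(ν+2j) / (j! Γ(ν+j+1))` (principal powers). -/
noncomputable def besselI (ν z : ℂ) : ℂ :=
  ∑' j : ℕ, (z / 2) ^ (ν + 2 * (j : ℂ)) / ((j.factorial : ℂ) * Complex.Gamma (ν + j + 1))

/-- The quotient `(π/2) (I_{-ν}(z) - I_ν(z)) / sin (πν)`, meaningful for non-integral `ν`. -/
noncomputable def besselKQuot (ν z : ℂ) : ℂ :=
  (Real.pi : ℂ) / 2 * ((besselI (-ν) z - besselI ν z) / Complex.sin (Real.pi * ν))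

open Classical in
/-- The modified Bessel function of the second kind `K_ν(z)`: the quotient above for `ν ∉ ℤ`,
and its limit as the order tends to `ν` when `ν ∈ ℤ`. -/
noncomputable def besselK (ν z : ℂ) : ℂ :=
  if ∃ n : ℤ, ν = n then Filter.limUnder (nhdsWithin ν {ν}ᶜ) (fun μ => besselKQuot μ z)
  else besselKQuot ν z

/-- `∑_{d ∣ n} d^k sin (2πnθ/d)`. -/
noncomputable def sinDivisorSum (k : ℕ) (θ : ℝ) (n : ℕ) : ℝ :=
  ∑ d ∈ n.divisors, (d : ℝ) ^ k * Real.sin (2 * Real.pi * n * θ / d)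

/-- `σ_{k,χ̄}(n) = ∑_{d ∣ n} d^k χ̄(d)`. -/
noncomputable def twistedSigmaConj {q : ℕ} (k : ℕ) (χ : DirichletCharacter ℂ q) (n : ℕ) : ℂ :=
  ∑ d ∈ n.divisors, (d : ℂ) ^ k * starRingEnd ℂ (χ (d : ZMod q))

/-- `σ̄_{k,χ}(n) = ∑_{d ∣ n} d^k χ(n/d)`. -/
noncomputable def twistedSigmaBar {q : ℕ} (k : ℕ) (χ : DirichletCharacter ℂ q) (n : ℕ) : ℂ :=
  ∑ d ∈ n.divisors, (d : ℂ) ^ k * χ ((n / d : ℕ) : ZMod q)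

/-- The summand `n^(ν/2) K_ν(a √(nx)) ∑_{d ∣ n} d^k sin (2πnθ/d)`. -/
noncomputable def sineBesselTerm (k : ℕ) (ν : ℂ) (a x θ : ℝ) (n : ℕ) : ℂ :=
  (n : ℂ) ^ (ν / 2) * besselK ν ((a * Real.sqrt (n * x) : ℝ) : ℂ) * (sinDivisorSum k θ n : ℂ)

/-- `t^k / (1 + 16π² r t / (a² x))^(1+ν+k)`; it is used with `t = m + θ` and `t = m + 1 - θ`. -/
noncomputable def rationalTerm (k : ℕ) (ν : ℂ) (a x : ℝ) (r : ℕ) (t : ℝ) : ℂ :=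
  (t : ℂ) ^ k / ((1 + 16 * Real.pi ^ 2 * r / (a ^ 2 * x) * t : ℝ) : ℂ) ^ (1 + ν + k)

/-- The sine identity at the parameters `k, ν, a, x, θ`: the Bessel series and the double series
converge absolutely, and the identity between them holds. -/
def SineBesselIdentity (k : ℕ) (ν : ℂ) (a x θ : ℝ) : Prop :=
  Summable (fun n : ℕ+ => sineBesselTerm k ν a x θ n) ∧
  Summable (fun p : ℕ+ × ℕ =>
    rationalTerm k ν a x p.1 (p.2 + θ) - rationalTerm k ν a x p.1 (p.2 + 1 - θ)) ∧
  ((a ^ 2 * x / 4 : ℝ) : ℂ) ^ (ν / 2 + k + 1) * ∑' n : ℕ+, sineBesselTerm k ν a x θ n =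
    (-1 : ℂ) ^ (k / 2) * 2 ^ k * (Real.pi : ℂ) ^ (k + 1) / 4 * Complex.Gamma (ν + k + 1) *
      (HurwitzZeta.hurwitzZeta (θ : UnitAddCircle) (-(k : ℂ)) -
        HurwitzZeta.hurwitzZeta ((1 - θ : ℝ) : UnitAddCircle) (-(k : ℂ))) +
    (-1 : ℂ) ^ (k / 2) / 4 * (2 * (Real.pi : ℂ)) ^ (k + 1) * Complex.Gamma (ν + k + 1) *
      ∑' r : ℕ+, ∑' m : ℕ,
        (rationalTerm k ν a x r (m + θ) - rationalTerm k ν a x r (m + 1 - θ))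

/-- The character identity at the parameters `k, ν, a, x` for a Dirichlet character `χ` modulo `q`:
both series converge absolutely, and the identity between them holds. The Gauss sum is
`τ(χ) = ∑_h χ(h) e^(2πih/q)`. -/
def CharacterBesselIdentity (k : ℕ) (ν : ℂ) (a x : ℝ) {q : ℕ} [NeZero q]
    (χ : DirichletCharacter ℂ q) : Prop :=
  Summable (fun n : ℕ+ => twistedSigmaBar k χ n * (n : ℂ) ^ (ν / 2) *
    besselK ν ((a * Real.sqrt (n * x) : ℝ) : ℂ)) ∧
  Summable (fun n : ℕ+ => twistedSigmaConj k χ n *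
    (Complex.Gamma (ν + k + 1) /
      ((16 * Real.pi ^ 2 / (a ^ 2 * q) * (n / x) + 1 : ℝ) : ℂ) ^ (ν + k + 1))) ∧
  ((a ^ 2 * x / 4 : ℝ) : ℂ) ^ (ν / 2 + k + 1) *
      ∑' n : ℕ+, twistedSigmaBar k χ n * (n : ℂ) ^ (ν / 2) *
        besselK ν ((a * Real.sqrt (n * x) : ℝ) : ℂ) =
    (k.factorial : ℂ) / 2 * Complex.Gamma (ν + k + 1) *
      DirichletCharacter.LFunction χ (1 + (k : ℂ)) -
    (-1 : ℂ) ^ (k / 2) * Complex.I / 2 * gaussSum χ (ZMod.stdAddChar (N := q)) *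
      (2 * (Real.pi : ℂ) / q) ^ (k + 1) *
      ∑' n : ℕ+, twistedSigmaConj k χ n *
        (Complex.Gamma (ν + k + 1) /
          ((16 * Real.pi ^ 2 / (a ^ 2 * q) * (n / x) + 1 : ℝ) : ℂ) ^ (ν + k + 1))

open Complex Filter Topology Set MeasureTheory

/-! Both identities come from one modular transformation. Since `2 w^(ν/2) K_ν(2√w) = ∫_0^∞ t^(ν-1)
e^(-t-w/t) dt`, the Bessel series is, with `c = a²x/4`, an integral over `t` of the Lambert series
`∑ sinDivisorSum(n) e^(-ny)` at `y = c/t`.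

`tsum_sinDivisorSum_mul_exp` transforms that series by using the Lipschitz formula twice. For `n =
dm`, summing over `d` gives a double sum of `sin(2πmθ) (my ± 2πir)^(-k-1)`; for fixed `r ≠ 0`, the
sum over `m` is again a Lipschitz sum, now shifted by `θ` and `1 - θ`. The term `r = 0` leaves `∑
sin(2πmθ)/m^(k+1)`, the Hurwitz zeta difference in Bernoulli form. Integrating against `t^(ν+k)
e^(-t)` turns each exponential into a rational term and produces the factor `Γ(ν+k+1)`.

The integral formula for `K_ν` has to be derived from the quotient of `I_{±ν}`. The defect between
the two sides at orders `ν` and `1 - ν` solves a linear first-order system with zero limit at `w =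
0`; for real orders in `(0,1)` an energy estimate forces it to vanish, analyticity in the order
extends this to all `ν`, and continuity handles the limit at integers.

For characters, the sine identities at `θ = h/q` are averaged against `χ⁻¹(h)`; Gauss sums turn
sines into `χ`, and residue classes merge the shifted sums. The converse in the equivalence is
immediate because the sine identity is proved unconditionally. -/

/-! ### The power series of `I_ν` -/

/-- The entire part of the Bessel function: `I_ν(z) = (z/2)^ν besselV ν (z²/4)`. -/
noncomputable def besselV (ν w : ℂ) : ℂ :=
  ∑' j : ℕ, w ^ j / (j.factorial : ℂ) * (Gamma (ν + j + 1))⁻¹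

/-- Once `j ≥ R`, the factor `ν + j + 1` has norm at least 1, so by the functional equation passing
from `j` to `j + 1` does not increase `1/Γ`. The finitely many smaller `j` are bounded by
compactness. -/
lemma exists_bound_inv_Gamma_add_nat (R : ℝ) :
    ∃ M : ℝ, 0 ≤ M ∧ ∀ (j : ℕ) (ν : ℂ), ‖ν‖ ≤ R → ‖(Gamma (ν + j + 1))⁻¹‖ ≤ M := by
  have hcpt : ∀ j : ℕ, ∃ M : ℝ, ∀ ν : ℂ, ‖ν‖ ≤ R → ‖(Gamma (ν + j + 1))⁻¹‖ ≤ M := by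
    intro j
    have hc : Continuous fun ν : ℂ => (Gamma (ν + j + 1))⁻¹ :=
      differentiable_one_div_Gamma.continuous.comp (by fun_prop)
    obtain ⟨M, hM⟩ := (isCompact_closedBall (0 : ℂ) R).exists_bound_of_continuousOn hc.continuousOn
    exact ⟨M, fun ν hν => hM ν (by simpa using hν)⟩
  choose M hM using hcpt
  obtain ⟨J, hJ⟩ := exists_nat_ge R
  refine ⟨∑ j ∈ Finset.range (J + 1), |M j|, Finset.sum_nonneg fun _ _ => abs_nonneg _, ?_⟩
  have hsmall : ∀ j ≤ J, ∀ ν : ℂ, ‖ν‖ ≤ R →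
      ‖(Gamma (ν + j + 1))⁻¹‖ ≤ ∑ j ∈ Finset.range (J + 1), |M j| := fun j hj ν hν =>
    ((hM j ν hν).trans (le_abs_self _)).trans
      (Finset.single_le_sum (f := fun j => |M j|) (fun _ _ => abs_nonneg _)
        (Finset.mem_range.2 (by omega)))
  intro j ν hν
  rcases le_total j J with h | h
  · exact hsmall j h ν hν
  induction j, h using Nat.le_induction with
  | base => exact hsmall J le_rfl ν hν
  | succ j hj ih =>
    have h1 : 1 ≤ ‖ν + j + 1‖ := by
      have h2 : ‖((j : ℂ) + 1)‖ ≤ ‖ν + j + 1‖ + ‖ν‖ := by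
        calc ‖((j : ℂ) + 1)‖ = ‖(ν + j + 1) - ν‖ := by congr 1; ring
          _ ≤ _ := norm_sub_le _ _
      have h3 : ‖((j : ℂ) + 1)‖ = j + 1 := by exact_mod_cast Complex.norm_natCast (j + 1)
      have h4 : (J : ℝ) ≤ j := by exact_mod_cast hj
      linarith
    have h0 : ν + j + 1 ≠ 0 := fun h => by rw [h, norm_zero] at h1; linarith
    have : ν + ((j + 1 : ℕ) : ℂ) + 1 = (ν + j + 1) + 1 := by push_cast; ring
    rw [this, Gamma_add_one _ h0, mul_inv, norm_mul, norm_inv]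
    calc _ ≤ 1 * ‖(Gamma (ν + j + 1))⁻¹‖ :=
          mul_le_mul_of_nonneg_right (inv_le_one_of_one_le₀ h1) (norm_nonneg _)
      _ ≤ _ := by rw [one_mul]; exact ih

lemma exists_summable_bound_besselV (R T : ℝ) :
    ∃ u : ℕ → ℝ, Summable u ∧ ∀ (j : ℕ) (ν w : ℂ), ‖ν‖ ≤ R → ‖w‖ ≤ T →
      ‖w ^ j / (j.factorial : ℂ) * (Gamma (ν + j + 1))⁻¹‖ ≤ u j := by
  obtain ⟨M, hM0, hM⟩ := exists_bound_inv_Gamma_add_nat R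
  refine ⟨fun j => T ^ j / j.factorial * M, (Real.summable_pow_div_factorial T).mul_right M, ?_⟩
  intro j ν w hν hw
  rw [norm_mul, norm_div, norm_pow, Complex.norm_natCast]
  have hT : 0 ≤ T := (norm_nonneg w).trans hw
  exact mul_le_mul (by gcongr) (hM j ν hν) (norm_nonneg _) (by positivity)

lemma summable_besselV (ν w : ℂ) :
    Summable fun j : ℕ => w ^ j / (j.factorial : ℂ) * (Gamma (ν + j + 1))⁻¹ := by
  obtain ⟨u, hu, h⟩ := exists_summable_bound_besselV ‖ν‖ ‖w‖
  exact hu.of_norm_bounded fun j => h j ν w le_rfl le_rfl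

lemma differentiable_besselV_order (w : ℂ) : Differentiable ℂ fun ν => besselV ν w := by
  intro ν
  obtain ⟨u, hu, h⟩ := exists_summable_bound_besselV (‖ν‖ + 1) ‖w‖
  have hd := differentiableOn_tsum_of_summable_norm (U := Metric.ball (0 : ℂ) (‖ν‖ + 1))
    (F := fun (j : ℕ) ν => w ^ j / (j.factorial : ℂ) * (Gamma (ν + j + 1))⁻¹) hu
    (fun j => ((differentiable_one_div_Gamma.comp
      (f := fun ν : ℂ => ν + j + 1) (by fun_prop)).const_mul _).differentiableOn)
    Metric.isOpen_ball (fun j μ hμ => h j μ w (by simpa using (mem_ball_zero_iff.1 hμ).le) le_rfl)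
  exact hd.differentiableAt (Metric.isOpen_ball.mem_nhds (by simp))

lemma hasDerivAt_besselV (ν w : ℂ) : HasDerivAt (besselV ν) (besselV (ν + 1) w) w := by
  obtain ⟨u, hu, h⟩ := exists_summable_bound_besselV ‖ν‖ (‖w‖ + 1)
  let F : ℕ → ℂ → ℂ := fun j w => w ^ j / (j.factorial : ℂ) * (Gamma (ν + j + 1))⁻¹
  have hw : w ∈ Metric.ball (0 : ℂ) (‖w‖ + 1) := by simp
  have hF : ∀ j, DifferentiableOn ℂ (F j) (Metric.ball (0 : ℂ) (‖w‖ + 1)) := fun j => by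
    simp only [F]; fun_prop
  have hle : ∀ j, ∀ z ∈ Metric.ball (0 : ℂ) (‖w‖ + 1), ‖F j z‖ ≤ u j := fun j z hz =>
    h j ν z le_rfl (by simpa using (mem_ball_zero_iff.1 hz).le)
  have hd := differentiableOn_tsum_of_summable_norm hu hF Metric.isOpen_ball hle
  have hs := hasSum_deriv_of_summable_norm hu hF Metric.isOpen_ball hle hw
  have hda : DifferentiableAt ℂ (besselV ν) w :=
    hd.differentiableAt (Metric.isOpen_ball.mem_nhds hw)
  have key : HasSum (fun j => deriv (F j) w) (besselV (ν + 1) w) := by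
    rw [← hasSum_nat_add_iff' 1]
    have h0 : deriv (F 0) w = 0 := by simp [F]
    have hj : ∀ j, deriv (F (j + 1)) w =
        w ^ j / (j.factorial : ℂ) * (Gamma (ν + 1 + j + 1))⁻¹ := by
      intro j
      have : HasDerivAt (F (j + 1)) (((j + 1 : ℕ) * w ^ j) / ((j + 1).factorial : ℂ) *
          (Gamma (ν + (j + 1 : ℕ) + 1))⁻¹) w :=
        (((hasDerivAt_pow (j + 1) w).div_const _).mul_const _)
      rw [this.deriv, Nat.factorial_succ]
      have h1 : (j.factorial : ℂ) ≠ 0 := by exact_mod_cast j.factorial_ne_zero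
      have h2 : (j : ℂ) + 1 ≠ 0 := by exact_mod_cast j.succ_ne_zero
      have h3 : ν + ((j + 1 : ℕ) : ℂ) + 1 = ν + 1 + j + 1 := by push_cast; ring
      rw [h3]
      push_cast
      field_simp
    simp only [Finset.range_one, Finset.sum_singleton, h0, sub_zero, hj]
    exact (summable_besselV (ν + 1) w).hasSum
  have := hs.unique key
  exact this ▸ hda.hasDerivAt

/-- Write `1/Γ(ν+j) = (ν+j)/Γ(ν+j+1)` and split `ν + j`; the `j` part is an index shift. -/
lemma besselV_sub_one (ν w : ℂ) : besselV (ν - 1) w = ν * besselV ν w + w * besselV (ν + 1) w := by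
  have h1 : HasSum (fun j : ℕ => (j : ℂ) * w ^ j / (j.factorial : ℂ) * (Gamma (ν + j + 1))⁻¹)
      (w * besselV (ν + 1) w) := by
    rw [← hasSum_nat_add_iff' 1]
    simp only [Finset.range_one, Finset.sum_singleton, Nat.cast_zero, zero_mul, zero_div, sub_zero]
    refine ((summable_besselV (ν + 1) w).hasSum.mul_left w).congr_fun ?_
    intro j
    have h1 : (j.factorial : ℂ) ≠ 0 := by exact_mod_cast j.factorial_ne_zero
    have h2 : (j : ℂ) + 1 ≠ 0 := by exact_mod_cast j.succ_ne_zero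
    have h3 : ν + ((j + 1 : ℕ) : ℂ) + 1 = ν + 1 + j + 1 := by push_cast; ring
    rw [h3, Nat.factorial_succ]
    push_cast
    rw [pow_succ]
    field_simp
  have h2 := ((summable_besselV ν w).hasSum.mul_left ν).add h1
  refine HasSum.unique (summable_besselV (ν - 1) w).hasSum ?_
  refine h2.congr_fun ?_
  intro j
  have h3 : ν - 1 + j + 1 = ν + j := by ring
  rw [h3]
  -- At the pole, `Gamma 0 = 0` by convention, so its inverse is the correct value 0 of `1/Γ`.
  by_cases h : ν + j = 0
  · have : w ^ j / (j.factorial : ℂ) * (Gamma (ν + j))⁻¹ = 0 := by simp [h]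
    rw [this]
    linear_combination -(w ^ j / (j.factorial : ℂ) * (Gamma (ν + j + 1))⁻¹) * h
  · rw [Gamma_add_one _ h]
    field_simp

lemma besselV_zero (ν : ℂ) : besselV ν 0 = (Gamma (ν + 1))⁻¹ := by
  rw [besselV, tsum_eq_single 0 (fun j hj => by simp [hj])]
  simp

lemma besselI_two_mul (ν : ℂ) {h : ℝ} (hh : 0 < h) :
    besselI ν ((2 * h : ℝ) : ℂ) = (h : ℂ) ^ ν * besselV ν ((h ^ 2 : ℝ) : ℂ) := by
  have h0 : (h : ℂ) ≠ 0 := by exact_mod_cast hh.ne'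
  rw [besselI, besselV, ← tsum_mul_left]
  refine tsum_congr fun j => ?_
  have : ((2 * h : ℝ) : ℂ) / 2 = h := by push_cast; field_simp
  rw [this, cpow_add _ _ h0]
  have h2 : (h : ℂ) ^ (2 * (j : ℂ)) = ((h ^ 2 : ℝ) : ℂ) ^ j := by
    have : (2 * (j : ℂ)) = ((2 * j : ℕ) : ℂ) := by push_cast; ring
    rw [this, cpow_natCast, pow_mul]; push_cast; rfl
  rw [h2, div_eq_mul_inv, div_eq_mul_inv, mul_inv]
  ring

/-! ### The integral `∫ t^(ν-1) e^(-t-w/t) dt` -/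

/-- `∫_0^∞ t^(ν-1) e^(-t-w/t) dt`, which equals `2 w^(ν/2) K_ν(2√w)`. -/
noncomputable def besselKMellin (ν : ℂ) (w : ℝ) : ℂ :=
  mellin (fun t : ℝ => (Real.exp (-t - w / t) : ℂ)) ν

/-- The free exponent `N` supplies decay of any order: in `t` at 0, so the Mellin integral converges
for every `ν`, and in `w`, so the series over `n` converges. -/
lemma exp_neg_div_le {w t : ℝ} (hw : 0 < w) (ht : 0 < t) (N : ℕ) :
    Real.exp (-(w / t)) ≤ N.factorial * (t / w) ^ N := by
  have h := Real.pow_div_factorial_le_exp (x := w / t) (by positivity) N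
  have hN : (0 : ℝ) < N.factorial := by exact_mod_cast N.factorial_pos
  rw [Real.exp_neg]
  calc (Real.exp (w / t))⁻¹ ≤ ((w / t) ^ N / N.factorial)⁻¹ := by
        apply inv_anti₀ (by positivity) h
    _ = _ := by rw [inv_div, div_pow, div_pow]; field_simp

lemma continuousOn_exp_neg_sub_div (w : ℝ) :
    ContinuousOn (fun t : ℝ => (Real.exp (-t - w / t) : ℂ)) (Ioi 0) := by
  refine continuous_ofReal.comp_continuousOn (Real.continuous_exp.comp_continuousOn ?_)
  exact continuousOn_id.neg.sub (continuousOn_const.div continuousOn_id fun t ht => (ne_of_gt ht))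

lemma isBigO_exp_neg_sub_div_atTop {w : ℝ} (hw : 0 ≤ w) :
    (fun t : ℝ => (Real.exp (-t - w / t) : ℂ)) =O[atTop] fun t => Real.exp (-1 * t) := by
  refine Asymptotics.IsBigO.of_bound 1 ?_
  filter_upwards [eventually_gt_atTop 0] with t ht
  rw [one_mul, Complex.norm_real, Real.norm_eq_abs, Real.norm_eq_abs, Real.abs_exp, Real.abs_exp]
  have : 0 ≤ w / t := by positivity
  exact Real.exp_le_exp.2 (by linarith)

lemma isBigO_exp_neg_sub_div_zero {w : ℝ} (hw : 0 < w) (N : ℕ) :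
    (fun t : ℝ => (Real.exp (-t - w / t) : ℂ)) =O[𝓝[>] 0] fun t => t ^ (-(-N : ℝ)) := by
  refine Asymptotics.IsBigO.of_bound (N.factorial / w ^ N) ?_
  filter_upwards [self_mem_nhdsWithin] with t ht
  have ht : 0 < t := ht
  rw [Complex.norm_real, Real.norm_eq_abs, Real.norm_eq_abs, Real.abs_exp, neg_neg,
    Real.rpow_natCast, abs_of_pos (by positivity)]
  calc Real.exp (-t - w / t) ≤ Real.exp (-(w / t)) := Real.exp_le_exp.2 (by linarith)
    _ ≤ _ := exp_neg_div_le hw ht N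
    _ = _ := by rw [div_pow]; ring

lemma mellinConvergent_exp_neg_sub_div {w : ℝ} (hw : 0 < w) (ν : ℂ) :
    MellinConvergent (fun t : ℝ => (Real.exp (-t - w / t) : ℂ)) ν := by
  obtain ⟨N, hN⟩ := exists_nat_gt (-ν.re)
  exact mellinConvergent_of_isBigO_rpow_exp one_pos
    ((continuousOn_exp_neg_sub_div w).locallyIntegrableOn measurableSet_Ioi)
    (isBigO_exp_neg_sub_div_atTop hw.le) (isBigO_exp_neg_sub_div_zero hw N) (by linarith)

lemma differentiable_besselKMellin {w : ℝ} (hw : 0 < w) :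
    Differentiable ℂ fun ν => besselKMellin ν w := by
  intro ν
  obtain ⟨N, hN⟩ := exists_nat_gt (-ν.re)
  exact mellin_differentiableAt_of_isBigO_rpow_exp one_pos
    ((continuousOn_exp_neg_sub_div w).locallyIntegrableOn measurableSet_Ioi)
    (isBigO_exp_neg_sub_div_atTop hw.le) (isBigO_exp_neg_sub_div_zero hw N) (by linarith)

/-- The substitution `t ↦ w/t` preserves the exponential; it is carried out as a scaling by `w`
followed by inversion. -/
lemma besselKMellin_neg {w : ℝ} (hw : 0 < w) (ν : ℂ) :
    besselKMellin (-ν) w = (w : ℂ) ^ (-ν) * besselKMellin ν w := by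
  have h := mellin_comp_mul_left (fun t : ℝ => (Real.exp (-t - w / t) : ℂ)) ν hw
  rw [smul_eq_mul] at h
  rw [besselKMellin, besselKMellin, ← h, ← mellin_comp_inv]
  refine setIntegral_congr_fun measurableSet_Ioi fun t ht => ?_
  have ht : t ≠ 0 := ne_of_gt ht
  have : -t⁻¹ - w / t⁻¹ = -(w * t) - w / (w * t) := by field_simp; ring
  simp only [this]

lemma norm_cpow_mul_exp {t : ℝ} (ht : 0 < t) (ν : ℂ) (x : ℝ) :
    ‖(t : ℂ) ^ (ν - 1) • (Real.exp x : ℂ)‖ = t ^ (ν.re - 1) * Real.exp x := by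
  rw [norm_smul, norm_cpow_eq_rpow_re_of_pos ht, Complex.norm_real, Real.norm_eq_abs, Real.abs_exp]
  simp

lemma integral_norm_besselKMellin_le {w : ℝ} (hw : 0 < w) {ν : ℂ} (hν : 0 < ν.re) (N : ℕ) :
    ∫ t in Ioi (0 : ℝ), ‖(t : ℂ) ^ (ν - 1) • (Real.exp (-t - w / t) : ℂ)‖ ≤
      N.factorial * Real.Gamma (ν.re + N) * w ^ (-(N : ℝ)) := by
  have hN : 0 < ν.re + N := by positivity
  rw [Real.Gamma_eq_integral hN, mul_assoc, ← integral_mul_const, ← integral_const_mul]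
  refine setIntegral_mono_on (mellinConvergent_exp_neg_sub_div hw ν).norm ?_ measurableSet_Ioi ?_
  · exact ((Real.GammaIntegral_convergent hN).mul_const _).const_mul _
  · intro t ht
    have ht : 0 < t := ht
    rw [norm_cpow_mul_exp ht, sub_eq_add_neg (-t), Real.exp_add,
      show ν.re + N - 1 = (ν.re - 1) + N by ring, Real.rpow_add ht, Real.rpow_natCast,
      Real.rpow_neg hw.le, Real.rpow_natCast]
    have h1 := exp_neg_div_le hw ht N
    have h2 : 0 < t ^ (ν.re - 1) := Real.rpow_pos_of_pos ht _
    calc t ^ (ν.re - 1) * (Real.exp (-t) * Real.exp (-(w / t)))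
        ≤ t ^ (ν.re - 1) * (Real.exp (-t) * (N.factorial * (t / w) ^ N)) := by gcongr
      _ = _ := by rw [div_pow]; ring

lemma tendsto_besselKMellin_zero {ν : ℂ} (hν : 0 < ν.re) :
    Tendsto (besselKMellin ν) (𝓝[>] 0) (𝓝 (Gamma ν)) := by
  rw [Gamma_eq_integral hν, GammaIntegral_eq_mellin]
  refine tendsto_integral_filter_of_dominated_convergence
    (fun t : ℝ => Real.exp (-t) * t ^ (ν.re - 1)) ?_ ?_ (Real.GammaIntegral_convergent hν) ?_
  · filter_upwards [self_mem_nhdsWithin] with w hw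
    exact (mellinConvergent_exp_neg_sub_div hw ν).aestronglyMeasurable
  · filter_upwards [self_mem_nhdsWithin] with w hw
    refine (ae_restrict_iff' measurableSet_Ioi).2 (Eventually.of_forall fun t ht => ?_)
    have ht : 0 < t := ht
    have hw : 0 < w := hw
    rw [norm_cpow_mul_exp ht, mul_comm]
    have : 0 ≤ w / t := by positivity
    gcongr
    linarith
  · refine (ae_restrict_iff' measurableSet_Ioi).2 (Eventually.of_forall fun t ht => ?_)
    have hc : Continuous fun w : ℝ => (t : ℂ) ^ (ν - 1) • (Real.exp (-t - w / t) : ℂ) := by fun_prop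
    have := hc.tendsto 0
    simp only [zero_div, sub_zero] at this
    exact this.mono_left nhdsWithin_le_nhds

/-- Differentiation under the integral: for parameters above `w/2`, the differentiated integrand is
dominated by its value at `w/2`. -/
lemma hasDerivAt_besselKMellin (ν : ℂ) {w : ℝ} (hw : 0 < w) :
    HasDerivAt (besselKMellin ν) (-besselKMellin (ν - 1) w) w := by
  have h2 : 0 < w / 2 := by linarith
  have key := hasDerivAt_integral_of_dominated_loc_of_deriv_le
    (μ := volume.restrict (Ioi (0 : ℝ))) (s := Ioi (w / 2)) (x₀ := w)
    (F := fun (w : ℝ) (t : ℝ) => (t : ℂ) ^ (ν - 1) • (Real.exp (-t - w / t) : ℂ))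
    (F' := fun (w : ℝ) (t : ℝ) => -((t : ℂ) ^ (ν - 1 - 1) • (Real.exp (-t - w / t) : ℂ)))
    (bound := fun t => ‖(t : ℂ) ^ (ν - 1 - 1) • (Real.exp (-t - (w / 2) / t) : ℂ)‖)
    (Ioi_mem_nhds (by linarith)) ?_ (mellinConvergent_exp_neg_sub_div hw ν)
    (mellinConvergent_exp_neg_sub_div hw (ν - 1)).aestronglyMeasurable.neg ?_
    (mellinConvergent_exp_neg_sub_div h2 (ν - 1)).norm ?_
  · have := key.2
    rwa [integral_neg] at this
  · filter_upwards [Ioi_mem_nhds hw] with v hv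
    exact (mellinConvergent_exp_neg_sub_div hv ν).aestronglyMeasurable
  · refine (ae_restrict_iff' measurableSet_Ioi).2 (Eventually.of_forall fun t ht v hv => ?_)
    have ht : 0 < t := ht
    have hv : w / 2 < v := hv
    rw [norm_neg, norm_cpow_mul_exp ht, norm_cpow_mul_exp ht]
    gcongr
  · refine (ae_restrict_iff' measurableSet_Ioi).2 (Eventually.of_forall fun t ht v hv => ?_)
    have ht : 0 < t := ht
    have ht0 : (t : ℂ) ≠ 0 := by exact_mod_cast ht.ne'
    have h1 : HasDerivAt (fun v : ℝ => Real.exp (-t - v / t)) (Real.exp (-t - v / t) * -(1 / t)) v :=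
      (((hasDerivAt_id v).div_const t).const_sub (-t)).exp
    refine (h1.ofReal_comp.const_smul ((t : ℂ) ^ (ν - 1))).congr_deriv ?_
    rw [cpow_sub (ν - 1) 1 ht0, cpow_one]
    simp only [smul_eq_mul]
    push_cast
    ring

/-! ### Identification of the integral with `K_ν` -/

/-- The energy `f² + g²` grows at rate at most `w^(s-1) + w^(-s)` times itself. For `0 < s < 1` this
rate is integrable at 0, so the energy times the integrating factor is nonincreasing, nonnegative
and tends to 0 at 0. -/
lemma eq_zero_of_coupled_deriv {s : ℝ} (hs0 : 0 < s) (hs1 : s < 1) {f g : ℝ → ℝ}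
    (hf : ∀ w, 0 < w → HasDerivAt f (-(w ^ (s - 1) * g w)) w)
    (hg : ∀ w, 0 < w → HasDerivAt g (-(w ^ (-s) * f w)) w)
    (hf0 : Tendsto f (𝓝[>] 0) (𝓝 0)) (hg0 : Tendsto g (𝓝[>] 0) (𝓝 0)) {w : ℝ} (hw : 0 < w) :
    f w = 0 := by
  let h : ℝ → ℝ := fun w => (f w ^ 2 + g w ^ 2) * Real.exp (-(w ^ s / s + w ^ (1 - s) / (1 - s)))
  have hd : ∀ v, 0 < v → HasDerivAt h
      (-((f v + g v) ^ 2 * (v ^ (s - 1) + v ^ (-s)) *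
        Real.exp (-(v ^ s / s + v ^ (1 - s) / (1 - s))))) v := by
    intro v hv
    have h1 : HasDerivAt (fun v : ℝ => v ^ s / s) (v ^ (s - 1)) v :=
      ((Real.hasDerivAt_rpow_const (Or.inl hv.ne')).div_const s).congr_deriv (by field_simp)
    have h2 : HasDerivAt (fun v : ℝ => v ^ (1 - s) / (1 - s)) (v ^ (-s)) v := by
      have h3 : 1 - s ≠ 0 := by linarith
      refine ((Real.hasDerivAt_rpow_const (p := 1 - s) (Or.inl hv.ne')).div_const (1 - s)).congr_deriv
        ?_
      rw [show 1 - s - 1 = -s by ring]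
      field_simp
    refine ((((hf v hv).pow 2).add ((hg v hv).pow 2)).mul (h1.add h2).neg.exp).congr_deriv ?_
    simp only [Pi.add_apply, Pi.neg_apply, Pi.pow_apply]
    ring
  have hanti : AntitoneOn h (Ioi 0) := by
    refine antitoneOn_of_deriv_nonpos (convex_Ioi 0)
      (fun v hv => (hd v hv).continuousAt.continuousWithinAt) ?_ ?_
    · rw [interior_Ioi]
      exact fun v hv => (hd v hv).differentiableAt.differentiableWithinAt
    · rw [interior_Ioi]
      intro v hv
      have hv : 0 < v := hv
      rw [(hd v hv).deriv]
      have : 0 ≤ v ^ (s - 1) + v ^ (-s) := by positivity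
      have := mul_nonneg (mul_nonneg (sq_nonneg (f v + g v)) this)
        (Real.exp_pos (-(v ^ s / s + v ^ (1 - s) / (1 - s)))).le
      linarith
  have hlim : Tendsto (fun v => f v ^ 2 + g v ^ 2) (𝓝[>] 0) (𝓝 0) := by
    simpa using (hf0.pow 2).add (hg0.pow 2)
  have hle : h w ≤ 0 := by
    refine ge_of_tendsto hlim ?_
    filter_upwards [Ioo_mem_nhdsGT hw] with v hv
    refine (hanti hv.1 hw hv.2.le).trans ?_
    have hv0 : 0 < v := hv.1
    have h3 : 0 < 1 - s := by linarith
    have : Real.exp (-(v ^ s / s + v ^ (1 - s) / (1 - s))) ≤ 1 := by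
      rw [Real.exp_le_one_iff, neg_nonpos]
      positivity
    exact mul_le_of_le_one_right (by positivity) this
  have hpos := Real.exp_pos (-(w ^ s / s + w ^ (1 - s) / (1 - s)))
  have : f w ^ 2 + g w ^ 2 ≤ 0 := nonpos_of_mul_nonpos_left hle hpos
  nlinarith [sq_nonneg (f w), sq_nonneg (g w)]

/-- The defect in the identity `sin(πν) ∫ t^(ν-1) e^(-t-w/t) dt = π (V_{-ν}(w) - w^ν V_ν(w))`. -/
noncomputable def besselKDefect (ν : ℂ) (w : ℝ) : ℂ :=
  sin (Real.pi * ν) * besselKMellin ν w -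
    Real.pi * (besselV (-ν) w - (w : ℂ) ^ ν * besselV ν w)

/-- The symmetry of the integral, the recurrence for `besselV` and `sin(π(1-ν)) = sin(πν)` close the
system on the pair `ν`, `1 - ν`. -/
lemma hasDerivAt_besselKDefect (ν : ℂ) {w : ℝ} (hw : 0 < w) :
    HasDerivAt (besselKDefect ν) (-((w : ℂ) ^ (ν - 1) * besselKDefect (1 - ν) w)) w := by
  have hw0 : (w : ℂ) ≠ 0 := by exact_mod_cast hw.ne'
  have h1 := (hasDerivAt_besselKMellin ν hw).const_mul (sin (Real.pi * ν))
  have h2 := (hasDerivAt_besselV (-ν) w).comp_ofReal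
  have h3 := (((hasDerivAt_id (w : ℂ)).cpow_const (c := ν) (Or.inl (by simpa using hw))).mul
    (hasDerivAt_besselV ν w)).comp_ofReal
  refine (h1.sub ((h2.sub h3).const_mul (Real.pi : ℂ))).congr_deriv ?_
  have h4 : besselKMellin (ν - 1) w = (w : ℂ) ^ (ν - 1) * besselKMellin (1 - ν) w := by
    have := besselKMellin_neg hw (1 - ν)
    rwa [neg_sub] at this
  have h5 : (w : ℂ) ^ ν = (w : ℂ) ^ (ν - 1) * w := by
    rw [cpow_sub _ _ hw0, cpow_one, div_mul_cancel₀ _ hw0]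
  have h6 : (w : ℂ) ^ (ν - 1) * (w : ℂ) ^ (1 - ν) = 1 := by
    rw [← cpow_add _ _ hw0]; simp
  have h7 : sin (Real.pi * (1 - ν)) = sin (Real.pi * ν) := by
    rw [mul_sub, mul_one, sin_pi_sub]
  simp only [besselKDefect, id, h4, h5, h7, neg_sub, mul_one, besselV_sub_one ν]
  rw [show -ν + 1 = 1 - ν by ring]
  linear_combination ((Real.pi : ℂ) * besselV (1 - ν) w) * h6

lemma sin_pi_mul_ne_zero_of_not_int {ν : ℂ} (hν : ¬∃ n : ℤ, ν = n) : sin (Real.pi * ν) ≠ 0 :=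
  sin_pi_mul_ne_zero fun ⟨n, hn⟩ => hν ⟨n, hn.symm⟩

/-- The limit is `sin(πν) Γ(ν) - π/Γ(1-ν)`, zero by the reflection formula; `w^ν` dies because `Re ν
> 0`. -/
lemma tendsto_besselKDefect_zero {ν : ℂ} (hν : 0 < ν.re) (hν1 : ν.re < 1) :
    Tendsto (besselKDefect ν) (𝓝[>] 0) (𝓝 0) := by
  have hV : ∀ μ : ℂ, Tendsto (fun w : ℝ => besselV μ w) (𝓝[>] 0) (𝓝 (Gamma (μ + 1))⁻¹) := by
    intro μ
    have hc : ContinuousAt (fun w : ℝ => besselV μ w) 0 :=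
      (hasDerivAt_besselV μ ((0 : ℝ) : ℂ)).continuousAt.comp continuous_ofReal.continuousAt
    have := hc.tendsto.mono_left (nhdsWithin_le_nhds (s := Ioi 0))
    simpa [besselV_zero] using this
  have hp : Tendsto (fun w : ℝ => (w : ℂ) ^ ν) (𝓝[>] 0) (𝓝 0) := by
    have hc := (continuousAt_ofReal_cpow_const 0 ν (Or.inl hν)).tendsto.mono_left
      (nhdsWithin_le_nhds (s := Ioi 0))
    have h0 : ν ≠ 0 := fun h => by simp [h] at hν
    simpa [zero_cpow h0] using hc
  have := ((tendsto_besselKMellin_zero hν).const_mul (sin (Real.pi * ν))).sub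
    (((hV (-ν)).sub (hp.mul (hV ν))).const_mul (Real.pi : ℂ))
  suffices h : sin (Real.pi * ν) * Gamma ν -
      Real.pi * ((Gamma (-ν + 1))⁻¹ - 0 * (Gamma (ν + 1))⁻¹) = 0 by rwa [h] at this
  have h1 : Gamma (-ν + 1) ≠ 0 := Gamma_ne_zero_of_re_pos (by simpa using hν1)
  have h2 := Gamma_mul_Gamma_one_sub ν
  have hs : sin (Real.pi * ν) ≠ 0 := by
    refine sin_pi_mul_ne_zero_of_not_int ?_
    rintro ⟨m, this⟩
    rw [this] at hν hν1
    simp only [intCast_re, Int.cast_pos] at hν hν1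
    have : m < 1 := by exact_mod_cast hν1
    omega
  rw [show 1 - ν = -ν + 1 by ring, eq_div_iff hs] at h2
  field_simp
  linear_combination h2

/-- For real order the coefficients `w^(s-1)` and `w^(-s)` are real, so real and imaginary parts
satisfy the coupled system separately. -/
lemma besselKDefect_eq_zero_of_mem_Ioo {s : ℝ} (hs0 : 0 < s) (hs1 : s < 1) {w : ℝ} (hw : 0 < w) :
    besselKDefect s w = 0 := by
  have hd : ∀ v : ℝ, 0 < v → HasDerivAt (besselKDefect s)
      (-(((v ^ (s - 1) : ℝ) : ℂ) * besselKDefect (1 - s : ℝ) v)) v := fun v hv => by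
    have := hasDerivAt_besselKDefect s hv
    rw [ofReal_cpow hv.le]
    push_cast
    exact this
  have hd' : ∀ v : ℝ, 0 < v → HasDerivAt (besselKDefect (1 - s : ℝ))
      (-(((v ^ (-s) : ℝ) : ℂ) * besselKDefect s v)) v := fun v hv => by
    have := hasDerivAt_besselKDefect (1 - s : ℝ) hv
    rw [ofReal_cpow hv.le]
    push_cast at this ⊢
    rwa [sub_sub_cancel, sub_sub_cancel_left] at this
  have ht : Tendsto (besselKDefect s) (𝓝[>] 0) (𝓝 0) :=
    tendsto_besselKDefect_zero (by simpa using hs0) (by simpa using hs1)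
  have ht' : Tendsto (besselKDefect (1 - s : ℝ)) (𝓝[>] 0) (𝓝 0) :=
    tendsto_besselKDefect_zero (by rw [ofReal_re]; linarith) (by rw [ofReal_re]; linarith)
  apply Complex.ext
  · refine eq_zero_of_coupled_deriv hs0 hs1 (f := fun v => (besselKDefect s v).re)
      (g := fun v => (besselKDefect (1 - s : ℝ) v).re) (fun v hv => ?_) (fun v hv => ?_) ?_ ?_ hw
    · have := reCLM.hasFDerivAt.comp_hasDerivAt v (hd v hv)
      simp only [reCLM_apply, neg_re, re_ofReal_mul] at this
      exact this
    · have := reCLM.hasFDerivAt.comp_hasDerivAt v (hd' v hv)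
      simp only [reCLM_apply, neg_re, re_ofReal_mul] at this
      exact this
    · exact (continuous_re.tendsto 0).comp ht
    · exact (continuous_re.tendsto 0).comp ht'
  · refine eq_zero_of_coupled_deriv hs0 hs1 (f := fun v => (besselKDefect s v).im)
      (g := fun v => (besselKDefect (1 - s : ℝ) v).im) (fun v hv => ?_) (fun v hv => ?_) ?_ ?_ hw
    · have := imCLM.hasFDerivAt.comp_hasDerivAt v (hd v hv)
      simp only [imCLM_apply, neg_im, im_ofReal_mul] at this
      exact this
    · have := imCLM.hasFDerivAt.comp_hasDerivAt v (hd' v hv)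
      simp only [imCLM_apply, neg_im, im_ofReal_mul] at this
      exact this
    · exact (continuous_im.tendsto 0).comp ht
    · exact (continuous_im.tendsto 0).comp ht'

/-- The defect is entire in `ν` and vanishes on `(0,1)`, which accumulates at `1/2`. -/
lemma besselKDefect_eq_zero (ν : ℂ) {w : ℝ} (hw : 0 < w) : besselKDefect ν w = 0 := by
  have hw0 : (w : ℂ) ≠ 0 := by exact_mod_cast hw.ne'
  have hd : Differentiable ℂ fun ν => besselKDefect ν w := by
    have h1 := differentiable_besselKMellin hw
    have h2 := differentiable_besselV_order (w : ℂ)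
    have h3 : Differentiable ℂ fun ν : ℂ => besselV (-ν) w := h2.comp differentiable_neg
    have h4 : Differentiable ℂ fun ν : ℂ => (w : ℂ) ^ ν :=
      fun ν => (differentiableAt_id.const_cpow (Or.inl hw0))
    unfold besselKDefect
    fun_prop
  have hfreq : ∃ᶠ z in 𝓝[≠] ((1 / 2 : ℝ) : ℂ), besselKDefect z w = 0 := by
    have ht : Tendsto (fun s : ℝ => (s : ℂ)) (𝓝[≠] (1 / 2)) (𝓝[≠] ((1 / 2 : ℝ) : ℂ)) :=
      tendsto_nhdsWithin_of_tendsto_nhds_of_eventually_within _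
        ((continuous_ofReal.tendsto _).mono_left nhdsWithin_le_nhds)
        (by filter_upwards [self_mem_nhdsWithin] with s hs h
            exact hs (ofReal_injective h))
    refine ht.frequently (Eventually.frequently ?_)
    have : Ioo (0 : ℝ) 1 ∈ 𝓝 (1 / 2 : ℝ) := Ioo_mem_nhds (by norm_num) (by norm_num)
    filter_upwards [mem_nhdsWithin_of_mem_nhds this] with s hs
    exact besselKDefect_eq_zero_of_mem_Ioo hs.1 hs.2 hw
  have := AnalyticOnNhd.eq_of_frequently_eq (Complex.analyticOnNhd_univ_iff_differentiable.2 hd)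
    (g := fun _ => (0 : ℂ)) analyticOnNhd_const hfreq
  exact congrFun this ν

lemma besselKQuot_eq {ν : ℂ} (hν : ¬∃ n : ℤ, ν = n) {h : ℝ} (hh : 0 < h) :
    besselKQuot ν ((2 * h : ℝ) : ℂ) = 1 / 2 * (h : ℂ) ^ (-ν) * besselKMellin ν (h ^ 2) := by
  have hs := sin_pi_mul_ne_zero_of_not_int hν
  have h0 : (h : ℂ) ≠ 0 := by exact_mod_cast hh.ne'
  have hd := besselKDefect_eq_zero ν (w := h ^ 2) (by positivity)
  have hsq : ((h ^ 2 : ℝ) : ℂ) ^ ν = (h : ℂ) ^ ν * (h : ℂ) ^ ν := by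
    rw [pow_two, ofReal_mul, mul_cpow_ofReal_nonneg hh.le hh.le]
  have hinv : (h : ℂ) ^ (-ν) * (h : ℂ) ^ ν = 1 := by rw [← cpow_add _ _ h0]; simp
  rw [besselKDefect, hsq] at hd
  rw [besselKQuot, besselI_two_mul _ hh, besselI_two_mul _ hh]
  field_simp
  linear_combination -(h : ℂ) ^ (-ν) * hd +
    (Real.pi : ℂ) * (h : ℂ) ^ ν * besselV ν ((h ^ 2 : ℝ) : ℂ) * hinv

lemma eventually_not_int (ν : ℂ) : ∀ᶠ μ : ℂ in 𝓝[≠] ν, ¬∃ n : ℤ, μ = n := by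
  have hd : AnalyticAt ℂ (fun μ : ℂ => sin (Real.pi * μ)) ν := by fun_prop
  rcases hd.eventually_eq_zero_or_eventually_ne_zero with h | h
  · exfalso
    have han : AnalyticOnNhd ℂ (fun μ : ℂ => sin (Real.pi * μ)) univ := fun μ _ => by fun_prop
    have := han.eq_of_eventuallyEq (g := fun _ => 0) analyticOnNhd_const h
    have h2 := congrFun this (1 / 2)
    rw [show (Real.pi : ℂ) * (1 / 2) = Real.pi / 2 by ring, sin_pi_div_two] at h2
    exact one_ne_zero h2
  · filter_upwards [h] with μ hμ
    rintro ⟨n, rfl⟩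
    exact hμ (by rw [mul_comm]; exact sin_int_mul_pi n)

/-- The integral representation of `K_ν` at positive arguments, for every order. -/
lemma besselK_two_mul (ν : ℂ) {h : ℝ} (hh : 0 < h) :
    besselK ν ((2 * h : ℝ) : ℂ) = 1 / 2 * (h : ℂ) ^ (-ν) * besselKMellin ν (h ^ 2) := by
  unfold besselK
  split_ifs with hν
  · have h0 : (h : ℂ) ≠ 0 := by exact_mod_cast hh.ne'
    -- The integral side is continuous in the order, so the limit defining `K_ν` at an integer is
    -- its value there.
    have hc : Continuous fun μ : ℂ =>
        1 / 2 * (h : ℂ) ^ (-μ) * besselKMellin μ (h ^ 2) := by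
      have h1 := (differentiable_besselKMellin (w := h ^ 2) (by positivity)).continuous
      have h2 : Continuous fun μ : ℂ => (h : ℂ) ^ (-μ) :=
        continuous_neg.const_cpow (Or.inl h0)
      fun_prop
    refine Tendsto.limUnder_eq (((hc.tendsto ν).mono_left nhdsWithin_le_nhds).congr' ?_)
    filter_upwards [eventually_not_int ν] with μ hμ
    exact (besselKQuot_eq hμ hh).symm
  · exact besselKQuot_eq hν hh

/-! ### Laplace transforms and Lipschitz summation -/

lemma integrableOn_pow_mul_cexp (k : ℕ) {p : ℂ} (hp : 0 < p.re) :
    IntegrableOn (fun x : ℝ => (x : ℂ) ^ k * exp (-p * x)) (Ioi 0) := by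
  have h := integrableOn_rpow_mul_exp_neg_mul_rpow (p := 1) (s := k) (b := p.re)
    (by have : (0 : ℝ) ≤ k := k.cast_nonneg
        linarith) one_pos hp
  refine Integrable.mono' h ((by fun_prop : Continuous fun x : ℝ =>
    (x : ℂ) ^ k * exp (-p * x)).aestronglyMeasurable) ?_
  refine (ae_restrict_iff' measurableSet_Ioi).2 (Eventually.of_forall fun x hx => ?_)
  have hx : 0 < x := hx
  rw [norm_mul, norm_pow, Complex.norm_exp, Complex.norm_real, Real.norm_eq_abs, abs_of_pos hx,
    Real.rpow_natCast, Real.rpow_one]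
  simp

lemma tendsto_pow_mul_cexp (k : ℕ) {p : ℂ} (hp : 0 < p.re) :
    Tendsto (fun x : ℝ => (x : ℂ) ^ k * exp (-p * x)) atTop (𝓝 0) := by
  rw [tendsto_zero_iff_norm_tendsto_zero]
  refine (tendsto_rpow_mul_exp_neg_mul_atTop_nhds_zero k p.re hp).congr' ?_
  filter_upwards [eventually_gt_atTop 0] with x hx
  rw [norm_mul, norm_pow, Complex.norm_exp, Complex.norm_real, Real.norm_eq_abs, abs_of_pos hx,
    Real.rpow_natCast]
  simp

lemma integral_pow_mul_cexp (k : ℕ) {p : ℂ} (hp : 0 < p.re) :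
    ∫ x : ℝ in Ioi 0, (x : ℂ) ^ k * exp (-p * x) = k.factorial / p ^ (k + 1) := by
  have hp0 : p ≠ 0 := fun h => by simp [h] at hp
  have hexp : ∀ x : ℝ, HasDerivAt (fun x : ℝ => exp (-p * x)) (exp (-p * x) * (-p)) x := fun x =>
    by simpa using (((hasDerivAt_id (x : ℂ)).const_mul (-p)).cexp).comp_ofReal
  induction k with
  | zero =>
    have h := integral_Ioi_of_hasDerivAt_of_tendsto' (a := 0)
      (fun x _ => (hexp x).const_mul (-p)⁻¹)
      ((integrableOn_pow_mul_cexp 0 hp).congr_fun (fun x _ => by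
        simp only [pow_zero, one_mul]; field_simp) measurableSet_Ioi)
      ((tendsto_pow_mul_cexp 0 hp).const_mul (-p)⁻¹ |>.congr (fun x => by simp))
    have h2 : ∀ x : ℝ, (-p)⁻¹ * (exp (-p * x) * (-p)) = (x : ℂ) ^ 0 * exp (-p * x) := fun x => by
      rw [pow_zero, one_mul]; field_simp
    simp only [h2] at h
    rw [h]
    simp
  | succ k ih =>
    have hi := (integrableOn_pow_mul_cexp k hp).const_mul ((k : ℂ) + 1)
    have hi' := (integrableOn_pow_mul_cexp (k + 1) hp).const_mul p
    have hd : ∀ x : ℝ, HasDerivAt (fun x : ℝ => (x : ℂ) ^ (k + 1) * exp (-p * x))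
        (((k : ℂ) + 1) * ((x : ℂ) ^ k * exp (-p * x)) - p * ((x : ℂ) ^ (k + 1) * exp (-p * x)))
        x := fun x => by
      have := (((hasDerivAt_pow (k + 1) (x : ℂ)).comp_ofReal).mul (hexp x))
      refine this.congr_deriv ?_
      simp only [Nat.add_sub_cancel]
      push_cast
      ring
    have h := integral_Ioi_of_hasDerivAt_of_tendsto' (a := 0) (fun x _ => hd x) (hi.sub hi')
      (tendsto_pow_mul_cexp (k + 1) hp)
    rw [integral_sub hi hi', integral_const_mul, integral_const_mul, ih] at h
    simp only [ofReal_zero, ne_eq, Nat.add_eq_zero_iff, one_ne_zero, and_false, not_false_eq_true,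
      zero_pow, zero_mul, sub_zero] at h
    have h3 : p * (∫ x : ℝ in Ioi 0, (x : ℂ) ^ (k + 1) * exp (-p * x)) =
        (k + 1) * (k.factorial / p ^ (k + 1)) := by linear_combination -h
    rw [eq_div_iff (pow_ne_zero _ hp0), pow_succ, mul_comm _ p, ← mul_assoc, mul_comm _ p, h3,
      Nat.factorial_succ]
    push_cast
    field_simp

lemma summable_lipschitz (k : ℕ) (hk : 1 ≤ k) (s : ℝ) :
    Summable fun n : ℤ => (k.factorial : ℂ) / (s + 2 * Real.pi * I * n) ^ (k + 1) := by
  have hs : Summable fun n : ℤ => (k.factorial : ℝ) * |1 / (n : ℝ) ^ (k + 1)| :=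
    ((Real.summable_one_div_int_pow.2 (by omega)).abs).mul_left _
  refine hs.of_norm_bounded_eventually ?_
  filter_upwards [(Set.finite_singleton (0 : ℤ)).compl_mem_cofinite] with n hn
  have hn : n ≠ 0 := hn
  have hn' : (0 : ℝ) < |(n : ℝ)| := by positivity
  rw [norm_div, norm_pow, Complex.norm_natCast, abs_div, abs_one, abs_pow, mul_one_div]
  gcongr
  have h1 : |(s + 2 * Real.pi * I * n : ℂ).im| ≤ ‖(s + 2 * Real.pi * I * n : ℂ)‖ := abs_im_le_norm _
  have h2 : (s + 2 * Real.pi * I * n : ℂ).im = 2 * Real.pi * n := by simp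
  rw [h2, abs_mul, abs_of_pos (by positivity)] at h1
  nlinarith [Real.pi_gt_three]

/-- The Lipschitz summation formula with a shift. -/
lemma tsum_pow_mul_exp_eq (k : ℕ) (hk : 1 ≤ k) {s : ℝ} (hs : 0 < s) {α : ℝ} (hα0 : 0 ≤ α)
    (hα1 : α < 1) :
    ∑' n : ℕ, (((n + α) ^ k * Real.exp (-s * (n + α)) : ℝ) : ℂ) =
      ∑' n : ℤ, (k.factorial : ℂ) / (s + 2 * Real.pi * I * n) ^ (k + 1) *
        exp (2 * Real.pi * I * n * α) := by
  -- Extending `x^k e^(-sx)` by zero keeps it continuous because `k ≥ 1`, so Poisson summation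
  -- applies; its Fourier transform is a Laplace integral.
  let f : ℝ → ℂ := fun x => (((max x 0) ^ k * Real.exp (-s * x) : ℝ) : ℂ)
  have hk0 : k ≠ 0 := by omega
  have hneg : ∀ x ≤ 0, f x = 0 := fun x hx => by simp [f, max_eq_right hx, hk0]
  have hposv : ∀ x, 0 ≤ x → f x = (((x ^ k * Real.exp (-s * x) : ℝ)) : ℂ) := fun x hx => by
    simp only [f, max_eq_left hx]
  have hc : Continuous f := by fun_prop
  have hO : f =O[cocompact ℝ] fun x : ℝ => |x| ^ (-2 : ℝ) := by
    rw [cocompact_eq_atBot_atTop, Asymptotics.isBigO_sup]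
    constructor
    · refine Asymptotics.IsBigO.of_bound 1 ?_
      filter_upwards [eventually_le_atBot 0] with x hx
      rw [hneg x hx, norm_zero]
      positivity
    · have h := tendsto_rpow_mul_exp_neg_mul_atTop_nhds_zero (k + 2) s hs
      refine Asymptotics.IsBigO.of_bound 1 ?_
      filter_upwards [h.eventually_le_const one_pos, eventually_gt_atTop 0] with x hx hx0
      rw [hposv x hx0.le, Complex.norm_real, Real.norm_eq_abs, Real.norm_eq_abs,
        abs_of_pos (by positivity), abs_of_pos (by positivity), abs_of_pos hx0,
        Real.rpow_neg hx0.le, one_mul, ← one_div, le_div_iff₀ (by positivity)]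
      refine le_trans (le_of_eq ?_) hx
      rw [Real.rpow_add hx0, Real.rpow_natCast]
      ring
  have hF : ∀ ξ : ℝ, FourierTransform.fourier f ξ =
      (k.factorial : ℂ) / (s + 2 * Real.pi * I * ξ) ^ (k + 1) := by
    intro ξ
    rw [Real.fourier_real_eq_integral_exp_smul, ← integral_pow_mul_cexp k (by simpa using hs),
      ← setIntegral_eq_integral_of_forall_compl_eq_zero (s := Ioi (0 : ℝ))]
    · refine setIntegral_congr_fun measurableSet_Ioi fun x hx => ?_
      have hx : 0 < x := hx
      simp only [hposv x hx.le, smul_eq_mul]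
      push_cast
      rw [mul_left_comm, ← Complex.exp_add]
      congr 2
      ring
    · intro x hx
      rw [hneg x (not_lt.1 hx), smul_zero]
  have hP := Real.tsum_eq_tsum_fourier_of_rpow_decay_of_summable hc one_lt_two hO
    (by simp only [hF]; exact_mod_cast summable_lipschitz k hk s) α
  simp only [hF, fourier_coe_apply] at hP
  have hL : ∑' n : ℤ, f (α + n) = ∑' n : ℕ, (((n + α) ^ k * Real.exp (-s * (n + α)) : ℝ) : ℂ) := by
    rw [← (Nat.cast_injective (R := ℤ)).tsum_eq]
    · refine tsum_congr fun n => ?_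
      rw [hposv _ (by positivity)]
      simp only [Int.cast_natCast, add_comm α]
    · intro n hn
      rw [Function.mem_support] at hn
      by_contra hcon
      refine hn (hneg _ ?_)
      -- Negative `n` contribute nothing, since `α < 1` gives `α + n < 0`.
      have : n ≤ -1 := by
        by_contra h
        exact hcon ⟨n.toNat, Int.toNat_of_nonneg (by omega)⟩
      have : (n : ℝ) ≤ -1 := by exact_mod_cast this
      linarith
  rw [← hL, hP]
  simp

lemma hasSum_sum_divisors {F : ℕ → ℕ → ℂ} (hF : Summable fun p : ℕ+ × ℕ+ => F p.1 p.2) :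
    HasSum (fun n : ℕ+ => ∑ d ∈ (n : ℕ).divisors, F d (n / d)) (∑' p : ℕ+ × ℕ+, F p.1 p.2) := by
  have h := (sigmaAntidiagonalEquivProd.hasSum_iff.2 hF.hasSum).sigma
    fun n => (hasSum_fintype _)
  refine h.congr_fun fun n => ?_
  rw [← Nat.sum_divisorsAntidiagonal (fun d e => F d e)]
  exact (Finset.sum_coe_sort _ (fun x : ℕ × ℕ => F x.1 x.2)).symm

lemma summable_int_pnat {f : ℤ → ℂ} (hf : Summable f) :
    Summable (fun n : ℕ+ => f n) ∧ Summable (fun n : ℕ+ => f (-n)) :=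
  ⟨hf.comp_injective (i := fun n : ℕ+ => (n : ℤ)) fun a b h => by simpa using h,
    hf.comp_injective (i := fun n : ℕ+ => -(n : ℤ)) fun a b h => by simpa using h⟩

lemma tsum_pnat_pow_mul_exp_eq (k : ℕ) (hk : 1 ≤ k) {s : ℝ} (hs : 0 < s) :
    ∑' d : ℕ+, ((d ^ k * Real.exp (-s * d) : ℝ) : ℂ) =
      k.factorial * (1 / (s : ℂ) ^ (k + 1) + ∑' r : ℕ+, (1 / (s + 2 * Real.pi * I * r) ^ (k + 1) +
        1 / (s - 2 * Real.pi * I * r) ^ (k + 1))) := by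
  have h := tsum_pow_mul_exp_eq k hk hs le_rfl one_pos
  have hsum := summable_lipschitz k hk s
  obtain ⟨h1, h2⟩ := summable_int_pnat hsum
  have hL : ∑' d : ℕ+, ((d ^ k * Real.exp (-s * d) : ℝ) : ℂ) =
      ∑' n : ℕ, (((n + 0) ^ k * Real.exp (-s * (n + 0)) : ℝ) : ℂ) := by
    simp only [add_zero]
    exact tsum_pnat_eq_tsum_of_eq_zero
      (f := fun n : ℕ => (((n : ℝ) ^ k * Real.exp (-s * n) : ℝ) : ℂ))
      (by simp [show k ≠ 0 by omega])
  rw [hL, h]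
  simp only [ofReal_zero, mul_zero, exp_zero, mul_one]
  rw [tsum_int_eq_zero_add_tsum_pnat hsum, add_assoc, ← h1.tsum_add h2, mul_add, ← tsum_mul_left]
  congr 1
  · simp [div_eq_mul_inv]
  · refine tsum_congr fun r => ?_
    push_cast
    ring_nf

/-- Replacing `θ` by `1 - θ` inverts the phases `e^(2πinθ)`, so the difference keeps only sines: the
term `n = 0` cancels and `n`, `-n` pair up. -/
lemma tsum_sub_pow_mul_exp_eq (k : ℕ) (hk : 1 ≤ k) {s : ℝ} (hs : 0 < s) {θ : ℝ} (hθ0 : 0 < θ)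
    (hθ1 : θ < 1) :
    ∑' n : ℕ, (((n + θ) ^ k * Real.exp (-s * (n + θ)) : ℝ) : ℂ) -
      ∑' n : ℕ, (((n + 1 - θ) ^ k * Real.exp (-s * (n + 1 - θ)) : ℝ) : ℂ) =
      2 * I * k.factorial * ∑' m : ℕ+, (Real.sin (2 * Real.pi * m * θ) : ℂ) *
        (1 / (s + 2 * Real.pi * I * m) ^ (k + 1) - 1 / (s - 2 * Real.pi * I * m) ^ (k + 1)) := by
  have hsum := summable_lipschitz k hk s
  have hbd : ∀ α : ℝ, Summable fun n : ℤ => (k.factorial : ℂ) /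
      (s + 2 * Real.pi * I * n) ^ (k + 1) * exp (2 * Real.pi * I * n * α) := fun α => by
    refine Summable.of_norm (hsum.norm.congr fun n => ?_)
    have : (2 * Real.pi * I * n * α : ℂ) = ((2 * Real.pi * n * α : ℝ) : ℂ) * I := by
      push_cast; ring
    rw [norm_mul, this, norm_exp_ofReal_mul_I, mul_one]
  have hB : ∑' n : ℕ, (((n + 1 - θ) ^ k * Real.exp (-s * (n + 1 - θ)) : ℝ) : ℂ) =
      ∑' n : ℕ, (((n + (1 - θ)) ^ k * Real.exp (-s * (n + (1 - θ))) : ℝ) : ℂ) := by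
    simp only [add_sub_assoc]
  have hper : ∀ n : ℤ, exp (2 * Real.pi * I * n * ((1 - θ : ℝ) : ℂ)) =
      exp (-(2 * Real.pi * I * n * θ)) := fun n => by
    have : (2 * Real.pi * I * n * ((1 - θ : ℝ) : ℂ)) =
        -(2 * Real.pi * I * n * θ) + n * (2 * Real.pi * I) := by push_cast; ring
    rw [this, Complex.exp_add, Complex.exp_int_mul_two_pi_mul_I, mul_one]
  rw [hB, tsum_pow_mul_exp_eq k hk hs hθ0.le hθ1,
    tsum_pow_mul_exp_eq k hk hs (by linarith) (by linarith : 1 - θ < 1),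
    ← (hbd θ).tsum_sub (hbd (1 - θ))]
  simp only [hper]
  have hs2 := (hbd θ).sub (hbd (1 - θ))
  simp only [hper] at hs2
  obtain ⟨h1, h2⟩ := summable_int_pnat hs2
  rw [tsum_int_eq_zero_add_tsum_pnat hs2, add_assoc, ← h1.tsum_add h2, ← tsum_mul_left]
  simp only [Int.cast_zero, mul_zero, zero_mul, neg_zero, sub_self, zero_add]
  refine tsum_congr fun m => ?_
  have hsin : (Real.sin (2 * Real.pi * m * θ) : ℂ) =
      (exp (-(2 * Real.pi * I * m * θ)) - exp (2 * Real.pi * I * m * θ)) * I / 2 := by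
    rw [ofReal_sin, Complex.sin]
    push_cast
    ring_nf
  rw [hsin]
  push_cast
  rw [show (s + 2 * Real.pi * I * (-(m : ℂ)) : ℂ) = s - 2 * Real.pi * I * m by ring,
    show (2 * Real.pi * I * (-(m : ℂ)) * θ : ℂ) = -(2 * Real.pi * I * m * θ) by ring, neg_neg]
  ring_nf
  simp only [I_sq]
  ring

/-! ### Modular transformation of the Lambert series -/

/-- The real-analytic kernel `1/(my + 2πir)^(k+1) + 1/(my - 2πir)^(k+1)`. -/
noncomputable def eisKernel (k : ℕ) (y : ℝ) (m r : ℕ+) : ℂ :=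
  1 / ((m * y : ℝ) + 2 * Real.pi * I * r) ^ (k + 1) +
    1 / ((m * y : ℝ) - 2 * Real.pi * I * r) ^ (k + 1)

/-- By AM-GM, `|my ± 2πir|² ≥ 4πy·mr`, so the kernel is `O((mr)^(-(k+1)/2))`, and `k ≥ 2` makes the
exponent exceed 1. This justifies exchanging the sums over `m` and `r`. -/
lemma summable_eisKernel (k : ℕ) (hk : 2 ≤ k) {y : ℝ} (hy : 0 < y) (θ : ℝ) :
    Summable fun p : ℕ+ × ℕ+ =>
      (Real.sin (2 * Real.pi * p.1 * θ) : ℂ) * eisKernel k y p.1 p.2 := by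
  set e : ℝ := ((k : ℝ) + 1) / 2 with he
  have he1 : 1 < e := by
    have : (2 : ℝ) ≤ k := by exact_mod_cast hk
    linarith
  have h0 : Summable fun n : ℕ+ => 1 / (n : ℝ) ^ e :=
    (Real.summable_one_div_nat_rpow.2 he1).comp_injective PNat.coe_injective
  have h2 : Summable fun p : ℕ+ × ℕ+ =>
      2 / (4 * Real.pi * y) ^ e * ((1 / (p.1 : ℝ) ^ e) * (1 / (p.2 : ℝ) ^ e)) :=
    (h0.mul_of_nonneg h0 (fun _ => by positivity) (fun _ => by positivity)).mul_left _
  refine h2.of_norm_bounded fun p => ?_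
  have hm : (0 : ℝ) < p.1 := by exact_mod_cast p.1.pos
  have hr : (0 : ℝ) < p.2 := by exact_mod_cast p.2.pos
  have key : ∀ z : ℂ, 4 * Real.pi * y * (p.1 * p.2) ≤ ‖z‖ ^ 2 →
      ‖1 / z ^ (k + 1)‖ ≤ 1 / (4 * Real.pi * y) ^ e * ((1 / (p.1 : ℝ) ^ e) * (1 / (p.2 : ℝ) ^ e)) := by
    intro z hz
    have h3 : ‖z‖ ^ (k + 1) = (‖z‖ ^ 2) ^ e := by
      rw [← Real.rpow_natCast, ← Real.rpow_natCast, ← Real.rpow_mul (norm_nonneg _)]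
      congr 1
      rw [he]; push_cast; ring
    rw [norm_div, norm_one, norm_pow, h3, one_div_mul_one_div, one_div_mul_one_div]
    refine one_div_le_one_div_of_le (by positivity) ?_
    rw [← Real.mul_rpow hm.le hr.le, ← Real.mul_rpow (by positivity) (by positivity)]
    exact Real.rpow_le_rpow (by positivity) hz (by positivity)
  have hpi := Real.pi_pos
  have hn : ∀ ε : ℝ, ε ^ 2 = 1 → 4 * Real.pi * y * (p.1 * p.2) ≤
      ‖((p.1 * y : ℝ) : ℂ) + ((ε * (2 * Real.pi * p.2) : ℝ) : ℂ) * I‖ ^ 2 := by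
    intro ε hε
    rw [Complex.sq_norm, normSq_add_mul_I, mul_pow ε, hε]
    nlinarith [sq_nonneg ((p.1 : ℝ) * y - 2 * Real.pi * p.2)]
  have h3 := key _ (hn 1 (by norm_num))
  have h4 := key _ (hn (-1) (by norm_num))
  rw [show ((p.1 * y : ℝ) : ℂ) + (((1 : ℝ) * (2 * Real.pi * p.2) : ℝ) : ℂ) * I =
    (p.1 * y : ℝ) + 2 * Real.pi * I * p.2 by push_cast; ring] at h3
  rw [show ((p.1 * y : ℝ) : ℂ) + (((-1 : ℝ) * (2 * Real.pi * p.2) : ℝ) : ℂ) * I =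
    (p.1 * y : ℝ) - 2 * Real.pi * I * p.2 by push_cast; ring] at h4
  have h5 : ‖(Real.sin (2 * Real.pi * p.1 * θ) : ℂ)‖ ≤ 1 := by
    rw [Complex.norm_real]; exact Real.abs_sin_le_one _
  calc _ ≤ 1 * ‖eisKernel k y p.1 p.2‖ := by
        rw [norm_mul]; exact mul_le_mul_of_nonneg_right h5 (norm_nonneg _)
    _ ≤ _ := by rw [one_mul]; exact norm_add_le _ _
    _ ≤ _ := add_le_add h3 h4
    _ = _ := by ring

lemma summable_sin_div_pow (k : ℕ) (hk : 2 ≤ k) (θ : ℝ) :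
    Summable fun m : ℕ+ => (Real.sin (2 * Real.pi * m * θ) : ℂ) / (m : ℂ) ^ (k + 1) := by
  have h : Summable fun n : ℕ+ => 1 / (n : ℝ) ^ (k + 1) :=
    (Real.summable_one_div_nat_pow.2 (by omega)).comp_injective PNat.coe_injective
  refine h.of_norm_bounded fun m => ?_
  rw [norm_div, norm_pow, Complex.norm_natCast, Complex.norm_real]
  gcongr
  exact Real.abs_sin_le_one _

lemma sinDivisorSum_mul_exp (k : ℕ) (θ y : ℝ) (n : ℕ+) :
    (sinDivisorSum k θ n : ℂ) * (Real.exp (-(n * y)) : ℂ) = ∑ d ∈ (n : ℕ).divisors,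
      (fun d m : ℕ => (Real.sin (2 * Real.pi * m * θ) : ℂ) *
        ((d ^ k * Real.exp (-(m * y) * d) : ℝ) : ℂ)) d (n / d) := by
  rw [sinDivisorSum, ofReal_sum, Finset.sum_mul]
  refine Finset.sum_congr rfl fun d hd => ?_
  have hdvd := Nat.dvd_of_mem_divisors hd
  have hd0 : (d : ℝ) ≠ 0 := by
    have := Nat.pos_of_mem_divisors hd
    positivity
  have h1 : ((n / d : ℕ) : ℝ) = n / d := Nat.cast_div hdvd hd0
  dsimp only
  rw [h1, show 2 * Real.pi * (n / d) * θ = 2 * Real.pi * n * θ / d by ring,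
    show -((n : ℝ) / d * y) * d = -(n * y) by field_simp]
  push_cast
  ring

lemma summable_sin_mul_pow_mul_exp (k : ℕ) (θ : ℝ) {y : ℝ} (hy : 0 < y) :
    Summable fun p : ℕ+ × ℕ+ => (Real.sin (2 * Real.pi * p.2 * θ) : ℂ) *
        (((p.1 : ℝ) ^ k * Real.exp (-(p.2 * y) * p.1) : ℝ) : ℂ) := by
  have h := summable_prod_mul_pow (𝕜 := ℝ) k (r := Real.exp (-y)) (by
    rw [Real.norm_eq_abs, Real.abs_exp, Real.exp_lt_one_iff]; linarith)
  refine ((Equiv.prodComm ℕ+ ℕ+).summable_iff.2 h).of_norm_bounded fun p => ?_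
  rw [norm_mul, Complex.norm_real, Complex.norm_real]
  have h5 : ‖Real.sin (2 * Real.pi * p.2 * θ)‖ ≤ 1 := Real.abs_sin_le_one _
  refine (mul_le_mul_of_nonneg_right h5 (norm_nonneg _)).trans (le_of_eq ?_)
  rw [one_mul, Real.norm_eq_abs, abs_of_nonneg (by positivity), Function.comp_apply]
  simp only [Equiv.prodComm_apply, Prod.fst_swap, Prod.snd_swap]
  rw [← Real.exp_nat_mul]
  congr 2
  push_cast
  ring

/-- The modular transformation of the Lambert series attached to `sinDivisorSum`. -/
lemma tsum_sinDivisorSum_mul_exp (k : ℕ) (hk : 2 ≤ k) (hk_even : Even k) {θ : ℝ} (hθ0 : 0 < θ)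
    (hθ1 : θ < 1) {y : ℝ} (hy : 0 < y) :
    (y : ℂ) ^ (k + 1) / 2 * ∑' n : ℕ+, (sinDivisorSum k θ n : ℂ) * (Real.exp (-(n * y)) : ℂ) =
      k.factorial / 2 * ∑' m : ℕ+, (Real.sin (2 * Real.pi * m * θ) : ℂ) / (m : ℂ) ^ (k + 1) +
      (-1 : ℂ) ^ (k / 2) / 4 * (2 * Real.pi) ^ (k + 1) * ∑' r : ℕ+,
        (∑' n : ℕ, (((n + θ) ^ k * Real.exp (-(4 * Real.pi ^ 2 * r / y) * (n + θ)) : ℝ) : ℂ) -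
          ∑' n : ℕ, (((n + 1 - θ) ^ k *
            Real.exp (-(4 * Real.pi ^ 2 * r / y) * (n + 1 - θ)) : ℝ) : ℂ)) := by
  have hy0 : (y : ℂ) ≠ 0 := by exact_mod_cast hy.ne'
  have hk1 : 1 ≤ k := by omega
  have hodd : ∀ z : ℂ, (-z) ^ (k + 1) = -z ^ (k + 1) := fun z => hk_even.add_one.neg_pow z
  have hkf : (k.factorial : ℂ) ≠ 0 := by exact_mod_cast k.factorial_ne_zero
  have hpi : (Real.pi : ℂ) ≠ 0 := by exact_mod_cast Real.pi_ne_zero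
  have hIk : I ^ k = (-1 : ℂ) ^ (k / 2) := by
    obtain ⟨l, rfl⟩ := hk_even
    rw [← two_mul, Nat.mul_div_cancel_left _ two_pos, pow_mul, I_sq]
  have hH := summable_eisKernel k hk hy θ
  have hS := summable_sin_div_pow k hk θ
  -- Lipschitz in `d` for each fixed `m`; its zero frequency gives the sine Dirichlet series.
  have hleft : ∑' n : ℕ+, (sinDivisorSum k θ n : ℂ) * (Real.exp (-(n * y)) : ℂ) =
      k.factorial / (y : ℂ) ^ (k + 1) *
        (∑' m : ℕ+, (Real.sin (2 * Real.pi * m * θ) : ℂ) / (m : ℂ) ^ (k + 1)) +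
      k.factorial * ∑' r : ℕ+, ∑' m : ℕ+,
        (Real.sin (2 * Real.pi * m * θ) : ℂ) * eisKernel k y m r := by
    have h1 := summable_sin_mul_pow_mul_exp k θ hy
    have hinner : ∀ m : ℕ+, ∑' d : ℕ+, (Real.sin (2 * Real.pi * m * θ) : ℂ) *
        (((d : ℝ) ^ k * Real.exp (-(m * y) * d) : ℝ) : ℂ) =
        k.factorial / (y : ℂ) ^ (k + 1) *
          ((Real.sin (2 * Real.pi * m * θ) : ℂ) / (m : ℂ) ^ (k + 1)) +
        k.factorial * ∑' r : ℕ+, (Real.sin (2 * Real.pi * m * θ) : ℂ) * eisKernel k y m r := by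
      intro m
      have hm : (0 : ℝ) < m * y := mul_pos (by exact_mod_cast m.pos) hy
      rw [tsum_mul_left, tsum_pnat_pow_mul_exp_eq k hk1 hm, tsum_mul_left]
      simp only [eisKernel]
      push_cast
      rw [mul_pow]
      field_simp
    have hprod : ∑' p : ℕ+ × ℕ+, (Real.sin (2 * Real.pi * p.2 * θ) : ℂ) *
        (((p.1 : ℝ) ^ k * Real.exp (-(p.2 * y) * p.1) : ℝ) : ℂ) =
        ∑' m : ℕ+, ∑' d : ℕ+, (Real.sin (2 * Real.pi * m * θ) : ℂ) *
          (((d : ℝ) ^ k * Real.exp (-(m * y) * d) : ℝ) : ℂ) := by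
      rw [← (Equiv.prodComm ℕ+ ℕ+).tsum_eq]
      exact ((Equiv.prodComm ℕ+ ℕ+).summable_iff.2 h1).tsum_prod
    have hcomm : ∑' r : ℕ+, ∑' m : ℕ+,
        (Real.sin (2 * Real.pi * m * θ) : ℂ) * eisKernel k y m r = ∑' m : ℕ+, ∑' r : ℕ+,
        (Real.sin (2 * Real.pi * m * θ) : ℂ) * eisKernel k y m r :=
      Summable.tsum_comm (f := fun m r : ℕ+ =>
        (Real.sin (2 * Real.pi * m * θ) : ℂ) * eisKernel k y m r) hH
    simp only [sinDivisorSum_mul_exp]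
    rw [(hasSum_sum_divisors (F := fun d m : ℕ => (Real.sin (2 * Real.pi * m * θ) : ℂ) *
        ((d ^ k * Real.exp (-(m * y) * d) : ℝ) : ℂ)) h1).tsum_eq, hprod, hcomm, ← tsum_mul_left,
      ← tsum_mul_left, ← (hS.mul_left _).tsum_add (hH.prod.mul_left _)]
    exact tsum_congr hinner
  have hright : ∀ r : ℕ+,
      (∑' n : ℕ, (((n + θ) ^ k * Real.exp (-(4 * Real.pi ^ 2 * r / y) * (n + θ)) : ℝ) : ℂ) -
          ∑' n : ℕ, (((n + 1 - θ) ^ k *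
            Real.exp (-(4 * Real.pi ^ 2 * r / y) * (n + 1 - θ)) : ℝ) : ℂ)) =
      2 * I * k.factorial / (2 * Real.pi * I / y) ^ (k + 1) *
        ∑' m : ℕ+, (Real.sin (2 * Real.pi * m * θ) : ℂ) * eisKernel k y m r := by
    intro r
    have hr : (0 : ℝ) < r := by exact_mod_cast r.pos
    rw [tsum_sub_pow_mul_exp_eq k hk1 (by positivity) hθ0 hθ1,
      div_eq_mul_inv _ ((2 * Real.pi * I / y : ℂ) ^ (k + 1)),
      mul_assoc _ ((2 * Real.pi * I / y : ℂ) ^ (k + 1))⁻¹,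
      ← tsum_mul_left (a := ((2 * Real.pi * I / y : ℂ) ^ (k + 1))⁻¹)]
    congr 1
    refine tsum_congr fun m => ?_
    -- The frequencies of the two Lipschitz sums agree up to the factor `±2πi/y`. As `k + 1` is odd,
    -- the minus sign in `e2` converts the difference of powers into the sum in `eisKernel`.
    have e1 : (((4 * Real.pi ^ 2 * r / y : ℝ) : ℂ) + 2 * Real.pi * I * m) =
        (2 * Real.pi * I / y) * ((m * y : ℝ) - 2 * Real.pi * I * r) := by
      push_cast
      field_simp
      linear_combination (4 * (Real.pi : ℂ) * r) * I_sq
    have e2 : (((4 * Real.pi ^ 2 * r / y : ℝ) : ℂ) - 2 * Real.pi * I * m) =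
        -((2 * Real.pi * I / y) * ((m * y : ℝ) + 2 * Real.pi * I * r)) := by
      push_cast
      field_simp
      linear_combination (4 * (Real.pi : ℂ) * r) * I_sq
    rw [e1, e2, hodd, mul_pow, mul_pow, eisKernel]
    rw [div_neg, sub_neg_eq_add]
    simp only [div_eq_mul_inv, one_mul, mul_inv]
    ring
  simp only [hright]
  rw [hleft, tsum_mul_left, mul_add]
  generalize ∑' m : ℕ+, (Real.sin (2 * Real.pi * m * θ) : ℂ) / (m : ℂ) ^ (k + 1) = S
  generalize ∑' r : ℕ+, ∑' m : ℕ+,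
    (Real.sin (2 * Real.pi * m * θ) : ℂ) * eisKernel k y m r = T
  congr 1
  · field_simp
  · rw [div_pow, mul_pow _ I, pow_succ I, hIk]
    have : (-1 : ℂ) ^ (k / 2) ≠ 0 := pow_ne_zero _ (by norm_num)
    field_simp
    ring

/-! ### Termwise integration -/

lemma integrable_tsum_of_summable_integral_norm {ι α : Type*} [Countable ι] [MeasurableSpace α]
    {μ : Measure α} {F : ι → α → ℂ} (hF_int : ∀ i, Integrable (F i) μ)
    (hF_sum : Summable fun i => ∫ a, ‖F i a‖ ∂μ) : Integrable (fun a => ∑' i, F i a) μ := by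
  have hlt : ∫⁻ a, ∑' i, ‖F i a‖ₑ ∂μ < ⊤ := by
    rw [lintegral_tsum fun i => (hF_int i).1.enorm]
    have h : ∀ i, ∫⁻ a, ‖F i a‖ₑ ∂μ = ENNReal.ofReal (∫ a, ‖F i a‖ ∂μ) := fun i =>
      (ofReal_integral_norm_eq_lintegral_enorm (hF_int i)).symm
    simp only [h]
    rw [← ENNReal.ofReal_tsum_of_nonneg (fun i => integral_nonneg fun _ => norm_nonneg _) hF_sum]
    exact ENNReal.ofReal_lt_top
  refine ⟨?_, ?_⟩
  · refine aestronglyMeasurable_of_tendsto_ae (atTop : Filter (Finset ι))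
      (f := fun s a => ∑ i ∈ s, F i a)
      (fun s => Finset.aestronglyMeasurable_fun_sum s fun i _ => (hF_int i).1) ?_
    have hae := ae_lt_top' (AEMeasurable.tsum fun i => (hF_int i).1.enorm) hlt.ne
    filter_upwards [hae] with a ha
    have hs : Summable fun i => ‖F i a‖₊ := ENNReal.tsum_coe_ne_top_iff_summable.1 ha.ne
    have hs' : Summable fun i => ‖F i a‖ := NNReal.summable_coe.2 hs
    exact hs'.of_norm.hasSum
  · exact (lintegral_mono fun a => enorm_tsum_le_tsum_enorm).trans_lt hlt

lemma summable_prod_rpow_shift {e₁ e₂ : ℝ} (h₁ : 1 < e₁) (h₂ : 1 < e₂) {α : ℝ} (hα : 0 < α)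
    (C : ℝ) :
    Summable fun p : ℕ+ × ℕ => C * (1 / (p.1 : ℝ) ^ e₁ * (1 / (p.2 + α) ^ e₂)) := by
  have h1 : Summable fun n : ℕ+ => 1 / (n : ℝ) ^ e₁ :=
    (Real.summable_one_div_nat_rpow.2 h₁).comp_injective PNat.coe_injective
  have h2 : Summable fun n : ℕ => 1 / ((n : ℝ) + α) ^ e₂ :=
    ((Real.summable_one_div_nat_add_rpow α e₂).2 h₂).congr fun n => by
      rw [abs_of_pos (by positivity)]
  exact (h1.mul_of_nonneg h2 (fun _ => by positivity) (fun _ => by positivity)).mul_left C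

/-- The summand `u^k e^(-bru t)` of the transformed Lambert series. -/
noncomputable def decayTerm (k : ℕ) (b r u t : ℝ) : ℝ := u ^ k * Real.exp (-(b * r * u * t))

lemma summable_decayTerm (k : ℕ) {b t α : ℝ} (hb : 0 < b) (ht : 0 < t) (hα : 0 < α) :
    Summable fun p : ℕ+ × ℕ => (decayTerm k b p.1 (p.2 + α) t : ℂ) := by
  refine (summable_prod_rpow_shift (e₁ := (k + 2 : ℕ)) (e₂ := 2)
    (by push_cast; linarith [k.cast_nonneg (α := ℝ)]) one_lt_two hα ((k + 2).factorial / (b * t) ^ (k + 2))).of_norm_bounded fun p => ?_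
  have hr : (0 : ℝ) < p.1 := by exact_mod_cast p.1.pos
  have hu : 0 < (p.2 : ℝ) + α := by positivity
  set u := (p.2 : ℝ) + α
  have h := exp_neg_div_le (w := b * p.1 * u * t) (t := 1) (by positivity) one_pos (k + 2)
  rw [div_one] at h
  rw [Complex.norm_real, Real.norm_eq_abs, decayTerm, abs_of_pos (by positivity),
    Real.rpow_natCast, Real.rpow_two]
  calc _ ≤ u ^ k * ((k + 2).factorial * (1 / (b * p.1 * u * t)) ^ (k + 2)) := by gcongr
    _ = _ := by
      have h2 : (1 / (b * p.1 * u * t)) ^ (k + 2) =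
          1 / ((b * t) ^ (k + 2) * p.1 ^ (k + 2) * (u ^ k * u ^ 2)) := by
        rw [← pow_add, ← mul_pow, ← mul_pow, div_pow, one_pow]; ring_nf
      rw [h2]
      field_simp

lemma integrableOn_cpow_mul_exp_mul_decayTerm (k : ℕ) {ν : ℂ} (hν : 0 < ν.re) {b r u : ℝ}
    (hb : 0 < b) (hr : 0 < r) (hu : 0 < u) :
    IntegrableOn (fun t : ℝ => (t : ℂ) ^ (ν + k) * (Real.exp (-t) : ℂ) *
      (decayTerm k b r u t : ℂ)) (Ioi 0) := by
  have hre : 0 < (ν + k + 1).re := by simp; positivity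
  have h := (Complex.GammaIntegral_convergent hre).norm.mul_const (u ^ k)
  refine Integrable.mono' h ?_ ?_
  · refine ContinuousOn.aestronglyMeasurable ?_ measurableSet_Ioi
    refine ContinuousOn.mul (ContinuousOn.mul ?_ (by fun_prop)) (by unfold decayTerm; fun_prop)
    exact fun t ht => (continuousAt_ofReal_cpow_const _ _
      (Or.inr (ne_of_gt ht))).continuousWithinAt
  · refine (ae_restrict_iff' measurableSet_Ioi).2 (Eventually.of_forall fun t ht => ?_)
    have ht : 0 < t := ht
    have h1 : |decayTerm k b r u t| ≤ u ^ k := by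
      rw [decayTerm, abs_of_pos (by positivity)]
      refine mul_le_of_le_one_right (by positivity) (Real.exp_le_one_iff.2 ?_)
      rw [neg_nonpos]; positivity
    rw [norm_mul, Complex.norm_real (decayTerm _ _ _ _ _), Real.norm_eq_abs,
      add_sub_cancel_right, mul_comm ((t : ℂ) ^ (ν + k))]
    gcongr

lemma integral_cpow_mul_exp_mul_decayTerm (k : ℕ) {ν : ℂ} (hν : 0 < ν.re) {b r u : ℝ}
    (hb : 0 < b) (hr : 0 < r) (hu : 0 < u) :
    ∫ t : ℝ in Ioi 0, (t : ℂ) ^ (ν + k) * (Real.exp (-t) : ℂ) * (decayTerm k b r u t : ℂ) =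
      Gamma (ν + k + 1) * ((u : ℂ) ^ k / ((1 + b * r * u : ℝ) : ℂ) ^ (1 + ν + k)) := by
  have hre : 0 < (ν + k + 1).re := by simp; positivity
  have hq : 0 < 1 + b * r * u := by positivity
  have h := integral_cpow_mul_exp_neg_mul_Ioi hre hq
  have h1 : (1 / ((1 + b * r * u : ℝ) : ℂ)) ^ (ν + k + 1) =
      1 / ((1 + b * r * u : ℝ) : ℂ) ^ (1 + ν + k) := by
    rw [one_div, inv_cpow _ _ (by rw [arg_ofReal_of_nonneg hq.le]; exact Real.pi_pos.ne),
      one_div, show ν + k + 1 = 1 + ν + k by ring]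
  rw [h1] at h
  rw [mul_div_assoc', mul_comm (Gamma _), mul_div_assoc, div_eq_mul_one_div (Gamma _),
    mul_comm (Gamma _), ← h, ← integral_const_mul]
  refine setIntegral_congr_fun measurableSet_Ioi fun t _ => ?_
  simp only [decayTerm, add_sub_cancel_right]
  push_cast
  rw [show -((1 + (b : ℂ) * r * u) * t) = -t + -(b * r * u * t) by ring, Complex.exp_add]
  ring

lemma norm_rationalTerm_eq (k : ℕ) (ν : ℂ) {q u : ℝ} (hq : 0 < q) (hu : 0 < u) :
    ‖(u : ℂ) ^ k / (q : ℂ) ^ (1 + ν + k)‖ = u ^ k / q ^ (1 + ν.re + k) := by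
  rw [norm_div, norm_pow, norm_cpow_eq_rpow_re_of_pos hq, Complex.norm_real, Real.norm_eq_abs,
    abs_of_pos hu]
  simp

/-- Dropping the 1 in the denominator leaves exponents `1 + Re ν + k` in `r` and `1 + Re ν` in `u`;
`Re ν > 0` makes both exceed 1. -/
lemma norm_rational_le (k : ℕ) {ν : ℂ} (hν : 0 < ν.re) {b r u : ℝ} (hb : 0 < b) (hr : 0 < r)
    (hu : 0 < u) : ‖(u : ℂ) ^ k / ((1 + b * r * u : ℝ) : ℂ) ^ (1 + ν + k)‖ ≤
      1 / b ^ (1 + ν.re + k) * (1 / r ^ (1 + ν.re + k) * (1 / u ^ (1 + ν.re))) := by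
  rw [norm_rationalTerm_eq k ν (by positivity) hu]
  calc u ^ k / (1 + b * r * u) ^ (1 + ν.re + k) ≤ u ^ k / (b * r * u) ^ (1 + ν.re + k) := by
        gcongr; linarith
    _ = _ := by
      rw [Real.mul_rpow (by positivity) hu.le, Real.mul_rpow hb.le hr.le, Real.rpow_add hu,
        Real.rpow_natCast]
      field_simp

lemma summable_rational (k : ℕ) {ν : ℂ} (hν : 0 < ν.re) {b α : ℝ} (hb : 0 < b) (hα : 0 < α) :
    Summable fun p : ℕ+ × ℕ => ((p.2 + α : ℝ) : ℂ) ^ k /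
      ((1 + b * p.1 * (p.2 + α) : ℝ) : ℂ) ^ (1 + ν + k) :=
  (summable_prod_rpow_shift (e₁ := 1 + ν.re + k) (e₂ := 1 + ν.re)
    (by linarith [k.cast_nonneg (α := ℝ)]) (by linarith) hα _).of_norm_bounded fun p =>
    norm_rational_le k hν hb (by exact_mod_cast p.1.pos) (by positivity)

/-- The norm of the integrand is the same integrand at order `Re ν`, so its integral is evaluated
exactly and is a rational term at that order. -/
lemma summable_integral_norm_decayTerm (k : ℕ) {ν : ℂ} (hν : 0 < ν.re) {b α : ℝ} (hb : 0 < b)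
    (hα : 0 < α) :
    Summable fun p : ℕ+ × ℕ => ∫ t : ℝ in Ioi 0, ‖(t : ℂ) ^ (ν + k) * (Real.exp (-t) : ℂ) *
      (decayTerm k b p.1 (p.2 + α) t : ℂ)‖ := by
  have hσ : 0 < ((ν.re : ℝ) : ℂ).re := by simpa using hν
  have h := ((summable_rational k hσ hb hα).mul_left (Gamma (ν.re + k + 1))).norm
  refine h.congr fun p => ?_
  have hr : (0 : ℝ) < p.1 := by exact_mod_cast p.1.pos
  have hu : 0 < (p.2 : ℝ) + α := by positivity
  rw [← integral_cpow_mul_exp_mul_decayTerm k hσ hb hr hu]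
  have : ∫ t : ℝ in Ioi 0, (t : ℂ) ^ ((ν.re : ℂ) + k) * (Real.exp (-t) : ℂ) *
      (decayTerm k b p.1 (p.2 + α) t : ℂ) =
      ((∫ t : ℝ in Ioi 0, ‖(t : ℂ) ^ (ν + k) * (Real.exp (-t) : ℂ) *
      (decayTerm k b p.1 (p.2 + α) t : ℂ)‖ : ℝ) : ℂ) := by
    rw [← integral_complex_ofReal]
    refine setIntegral_congr_fun measurableSet_Ioi fun t ht => ?_
    have ht : 0 < t := ht
    have hd : 0 < decayTerm k b p.1 (p.2 + α) t := by unfold decayTerm; positivity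
    simp only [norm_mul, norm_cpow_eq_rpow_re_of_pos ht, Complex.norm_real, Real.norm_eq_abs,
      Real.abs_exp, abs_of_pos hd]
    push_cast
    rw [ofReal_cpow ht.le]
    simp
  rw [this, Complex.norm_real, Real.norm_eq_abs, abs_of_nonneg]
  exact integral_nonneg fun _ => norm_nonneg _

lemma hasSum_integral_decayTerm (k : ℕ) {ν : ℂ} (hν : 0 < ν.re) {b α : ℝ} (hb : 0 < b)
    (hα : 0 < α) :
    IntegrableOn (fun t : ℝ => (t : ℂ) ^ (ν + k) * (Real.exp (-t) : ℂ) *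
      ∑' p : ℕ+ × ℕ, (decayTerm k b p.1 (p.2 + α) t : ℂ)) (Ioi 0) ∧
    ∫ t : ℝ in Ioi 0, (t : ℂ) ^ (ν + k) * (Real.exp (-t) : ℂ) *
      ∑' p : ℕ+ × ℕ, (decayTerm k b p.1 (p.2 + α) t : ℂ) =
    Gamma (ν + k + 1) * ∑' p : ℕ+ × ℕ, ((p.2 + α : ℝ) : ℂ) ^ k /
      ((1 + b * p.1 * (p.2 + α) : ℝ) : ℂ) ^ (1 + ν + k) := by
  have hint : ∀ p : ℕ+ × ℕ, IntegrableOn (fun t : ℝ => (t : ℂ) ^ (ν + k) * (Real.exp (-t) : ℂ) *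
      (decayTerm k b p.1 (p.2 + α) t : ℂ)) (Ioi 0) := fun p =>
    integrableOn_cpow_mul_exp_mul_decayTerm k hν hb (by exact_mod_cast p.1.pos) (by positivity)
  have hsum := summable_integral_norm_decayTerm k hν hb hα
  simp only [← tsum_mul_left]
  refine ⟨integrable_tsum_of_summable_integral_norm hint hsum, ?_⟩
  rw [← (hasSum_integral_of_summable_integral_norm hint hsum).tsum_eq]
  exact tsum_congr fun p =>
    integral_cpow_mul_exp_mul_decayTerm k hν hb (by exact_mod_cast p.1.pos) (by positivity)

lemma abs_sinDivisorSum_le (k : ℕ) (θ : ℝ) (n : ℕ) :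
    |sinDivisorSum k θ n| ≤ (n : ℝ) ^ (k + 1) := by
  calc |sinDivisorSum k θ n| ≤ ∑ d ∈ n.divisors, (n : ℝ) ^ k := by
        refine (Finset.abs_sum_le_sum_abs _ _).trans (Finset.sum_le_sum fun d hd => ?_)
        rw [abs_mul, abs_of_nonneg (by positivity)]
        have h1 : (d : ℝ) ≤ n := by exact_mod_cast Nat.divisor_le hd
        calc _ ≤ (n : ℝ) ^ k * 1 := by
              gcongr
              exact Real.abs_sin_le_one _
          _ = _ := mul_one _
    _ ≤ (n : ℝ) ^ (k + 1) := by
        rw [Finset.sum_const, nsmul_eq_mul, pow_succ']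
        gcongr
        exact_mod_cast Nat.card_divisors_le_self n

/-- With `a√(nx) = 2h` one has `h² = (a²x/4) n`, and the factor `n^(ν/2)` cancels the `n`-part of
`h^(-ν)`. -/
lemma sineBesselTerm_eq (k : ℕ) (ν : ℂ) {a x : ℝ} (ha : 0 < a) (hx : 0 < x) (θ : ℝ) (n : ℕ+) :
    sineBesselTerm k ν a x θ n = 1 / 2 * ((a ^ 2 * x / 4 : ℝ) : ℂ) ^ (-(ν / 2)) *
      ((sinDivisorSum k θ n : ℂ) * besselKMellin ν (a ^ 2 * x / 4 * n)) := by
  have hn : (0 : ℝ) < n := by exact_mod_cast n.pos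
  have hn0 : (n : ℂ) ≠ 0 := by exact_mod_cast n.ne_zero
  set h : ℝ := a * Real.sqrt (n * x) / 2 with hh
  have hpos : 0 < h := by positivity
  have h1 : a * Real.sqrt (n * x) = 2 * h := by rw [hh]; ring
  have h2 : h ^ 2 = a ^ 2 * x / 4 * n := by
    rw [hh, div_pow, mul_pow, Real.sq_sqrt (by positivity)]; ring
  have h3 : (h : ℂ) ^ (-ν) = ((a ^ 2 * x / 4 : ℝ) : ℂ) ^ (-(ν / 2)) * (n : ℂ) ^ (-(ν / 2)) := by
    rw [show (n : ℂ) = ((n : ℝ) : ℂ) by simp,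
      ← mul_cpow_ofReal_nonneg (by positivity) hn.le, ← ofReal_mul, ← h2, pow_two, ofReal_mul,
      mul_cpow_ofReal_nonneg hpos.le hpos.le, ← cpow_add _ _ (by exact_mod_cast hpos.ne')]
    congr 1
    ring
  have h4 : (n : ℂ) ^ (ν / 2) * (n : ℂ) ^ (-(ν / 2)) = 1 := by rw [← cpow_add _ _ hn0]; simp
  rw [sineBesselTerm, h1, besselK_two_mul ν hpos, h2, h3]
  linear_combination (1 / 2 * ((a ^ 2 * x / 4 : ℝ) : ℂ) ^ (-(ν / 2)) *
      ((sinDivisorSum k θ n : ℂ) * besselKMellin ν (a ^ 2 * x / 4 * n))) * h4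

lemma hasSum_sinDivisorSum_mul_besselKMellin (k : ℕ) {ν : ℂ} (hν : 0 < ν.re) {c : ℝ} (hc : 0 < c)
    (θ : ℝ) :
    HasSum (fun n : ℕ+ => (sinDivisorSum k θ n : ℂ) * besselKMellin ν (c * n))
      (∫ t : ℝ in Ioi 0, ∑' n : ℕ+, (sinDivisorSum k θ n : ℂ) *
        ((t : ℂ) ^ (ν - 1) • (Real.exp (-t - c * n / t) : ℂ))) := by
  have hcn : ∀ n : ℕ+, 0 < c * n := fun n => mul_pos hc (by exact_mod_cast n.pos)
  have hint : ∀ n : ℕ+, IntegrableOn (fun t : ℝ => (sinDivisorSum k θ n : ℂ) *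
      ((t : ℂ) ^ (ν - 1) • (Real.exp (-t - c * n / t) : ℂ))) (Ioi 0) := fun n =>
    (mellinConvergent_exp_neg_sub_div (hcn n) ν).const_mul _
  -- The coefficients are at most `n^(k+1)`, so decay of order `k + 3` leaves `1/n²`.
  have hs2 : Summable fun n : ℕ+ => (k + 3).factorial * Real.Gamma (ν.re + (k + 3 : ℕ)) *
      (1 / c ^ (k + 3)) * (1 / (n : ℝ) ^ 2) :=
    ((Real.summable_one_div_nat_pow.2 one_lt_two).comp_injective PNat.coe_injective).mul_left _
  have hsum : Summable fun n : ℕ+ => ∫ t : ℝ in Ioi 0, ‖(sinDivisorSum k θ n : ℂ) *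
      ((t : ℂ) ^ (ν - 1) • (Real.exp (-t - c * n / t) : ℂ))‖ := by
    refine hs2.of_nonneg_of_le (fun n => integral_nonneg fun _ => norm_nonneg _) fun n => ?_
    have hn : (0 : ℝ) < n := by exact_mod_cast n.pos
    simp only [norm_mul (sinDivisorSum k θ n : ℂ)]
    rw [integral_const_mul, Complex.norm_real, Real.norm_eq_abs]
    have h1 := integral_norm_besselKMellin_le (hcn n) hν (k + 3)
    rw [Real.rpow_neg (hcn n).le, Real.rpow_natCast] at h1
    calc _ ≤ (n : ℝ) ^ (k + 1) * _ := mul_le_mul (abs_sinDivisorSum_le k θ n) h1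
          (integral_nonneg fun _ => norm_nonneg _) (by positivity)
      _ = _ := by
        rw [mul_pow, show (n : ℝ) ^ (k + 3) = (n : ℝ) ^ (k + 1) * (n : ℝ) ^ 2 by ring]
        field_simp
  have h := hasSum_integral_of_summable_integral_norm hint hsum
  refine h.congr_fun fun n => ?_
  rw [integral_const_mul]
  rfl

/-- The integrated form of the modular transformation. -/
lemma tsum_sinDivisorSum_mul_besselKMellin (k : ℕ) (hk : 2 ≤ k) (hk_even : Even k) {ν : ℂ}
    (hν : 0 < ν.re) {c : ℝ} (hc : 0 < c) {θ : ℝ} (hθ0 : 0 < θ) (hθ1 : θ < 1) :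
    (c : ℂ) ^ (k + 1) / 2 *
        ∑' n : ℕ+, (sinDivisorSum k θ n : ℂ) * besselKMellin ν (c * n) =
      k.factorial / 2 * Gamma (ν + k + 1) *
        (∑' m : ℕ+, (Real.sin (2 * Real.pi * m * θ) : ℂ) / (m : ℂ) ^ (k + 1)) +
      (-1 : ℂ) ^ (k / 2) / 4 * (2 * Real.pi) ^ (k + 1) * Gamma (ν + k + 1) *
      (∑' p : ℕ+ × ℕ, ((p.2 + θ : ℝ) : ℂ) ^ k /
          ((1 + 4 * Real.pi ^ 2 / c * p.1 * (p.2 + θ) : ℝ) : ℂ) ^ (1 + ν + k) -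
        ∑' p : ℕ+ × ℕ, ((p.2 + (1 - θ) : ℝ) : ℂ) ^ k /
          ((1 + 4 * Real.pi ^ 2 / c * p.1 * (p.2 + (1 - θ)) : ℝ) : ℂ) ^ (1 + ν + k)) := by
  have hb : 0 < 4 * Real.pi ^ 2 / c := by positivity
  have hθ' : 0 < 1 - θ := by linarith
  have hre : 0 < (ν + k + 1).re := by simp; positivity
  obtain ⟨hi1, hv1⟩ := hasSum_integral_decayTerm k hν hb hθ0
  obtain ⟨hi2, hv2⟩ := hasSum_integral_decayTerm k hν hb hθ'
  have hi0 := Complex.GammaIntegral_convergent hre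
  have hv0 := Complex.Gamma_eq_integral hre
  rw [Complex.GammaIntegral] at hv0
  set S := ∑' m : ℕ+, (Real.sin (2 * Real.pi * m * θ) : ℂ) / (m : ℂ) ^ (k + 1)
  set κ : ℂ := (-1 : ℂ) ^ (k / 2) / 4 * (2 * Real.pi) ^ (k + 1)
  rw [(hasSum_sinDivisorSum_mul_besselKMellin k hν hc θ).tsum_eq, ← integral_const_mul]
  -- The transformation at `y = c/t`: `t^(ν-1) = t^(ν+k) t^(-(k+1))` supplies the factor `y^(k+1)`,
  -- and `4π²r/y = (4π²/c) r t` makes the dual exponentials linear in `t`.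
  have hpt : ∀ t ∈ Ioi (0 : ℝ), (c : ℂ) ^ (k + 1) / 2 * ∑' n : ℕ+, (sinDivisorSum k θ n : ℂ) *
        ((t : ℂ) ^ (ν - 1) • (Real.exp (-t - c * n / t) : ℂ)) =
      k.factorial / 2 * S * ((Real.exp (-t) : ℂ) * (t : ℂ) ^ (ν + k + 1 - 1)) +
      κ * ((t : ℂ) ^ (ν + k) * (Real.exp (-t) : ℂ) *
          ∑' p : ℕ+ × ℕ, (decayTerm k (4 * Real.pi ^ 2 / c) p.1 (p.2 + θ) t : ℂ) -
        (t : ℂ) ^ (ν + k) * (Real.exp (-t) : ℂ) *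
          ∑' p : ℕ+ × ℕ, (decayTerm k (4 * Real.pi ^ 2 / c) p.1 (p.2 + (1 - θ)) t : ℂ)) := by
    intro t ht
    have ht : 0 < t := ht
    have ht0 : (t : ℂ) ≠ 0 := by exact_mod_cast ht.ne'
    have hT := tsum_sinDivisorSum_mul_exp k hk hk_even hθ0 hθ1 (y := c / t) (by positivity)
    have hL : (c : ℂ) ^ (k + 1) / 2 * ∑' n : ℕ+, (sinDivisorSum k θ n : ℂ) *
        ((t : ℂ) ^ (ν - 1) • (Real.exp (-t - c * n / t) : ℂ)) =
        (t : ℂ) ^ (ν + k) * (Real.exp (-t) : ℂ) * (((c / t : ℝ) : ℂ) ^ (k + 1) / 2 *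
          ∑' n : ℕ+, (sinDivisorSum k θ n : ℂ) * (Real.exp (-(n * (c / t))) : ℂ)) := by
      rw [← tsum_mul_left, ← tsum_mul_left, ← tsum_mul_left]
      refine tsum_congr fun n => ?_
      have e1 : -t - c * n / t = -t + -(n * (c / t)) := by ring
      have e2 : (t : ℂ) ^ (ν + k) = (t : ℂ) ^ (ν - 1) * (t : ℂ) ^ (k + 1) := by
        rw [← cpow_natCast, ← cpow_add _ _ ht0]
        congr 1
        push_cast
        ring
      rw [e1, e2, Real.exp_add, smul_eq_mul]
      push_cast
      rw [div_pow]
      field_simp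
    have hG : ∀ α : ℝ, 0 < α → ∑' r : ℕ+, ∑' n : ℕ,
        (((n + α) ^ k * Real.exp (-(4 * Real.pi ^ 2 * r / (c / t)) * (n + α)) : ℝ) : ℂ) =
        ∑' p : ℕ+ × ℕ, (decayTerm k (4 * Real.pi ^ 2 / c) p.1 (p.2 + α) t : ℂ) := by
      intro α hα
      rw [(summable_decayTerm k hb ht hα).tsum_prod]
      refine tsum_congr fun r => tsum_congr fun n => ?_
      rw [decayTerm]
      congr 3
      field_simp
    have hsummable : ∀ α : ℝ, 0 < α → Summable fun r : ℕ+ => ∑' n : ℕ,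
        (((n + α) ^ k * Real.exp (-(4 * Real.pi ^ 2 * r / (c / t)) * (n + α)) : ℝ) : ℂ) := by
      intro α hα
      refine (summable_decayTerm k hb ht hα).prod.congr fun r => tsum_congr fun n => ?_
      rw [decayTerm]
      congr 3
      field_simp
    simp only [add_sub_assoc] at hT
    rw [hL, hT, (hsummable θ hθ0).tsum_sub (hsummable (1 - θ) hθ'), hG θ hθ0, hG (1 - θ) hθ',
      add_sub_cancel_right]
    ring
  rw [setIntegral_congr_fun measurableSet_Ioi hpt]
  refine (integral_add (hi0.const_mul _) ((hi1.sub hi2).const_mul κ)).trans ?_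
  rw [integral_const_mul, integral_const_mul]
  simp only [Pi.sub_apply]
  rw [integral_sub hi1 hi2, hv1, hv2]
  have hv0' : ∫ t : ℝ in Ioi 0, (Real.exp (-t) : ℂ) * (t : ℂ) ^ (ν + k + 1 - 1) =
      Gamma (ν + k + 1) := hv0.symm
  rw [hv0']
  ring

/-! ### Hurwitz zeta values and the sine identity -/

/-- Both sides are multiples of `B_{k+1}(θ)`: `ζ(-k,θ) = -B_{k+1}(θ)/(k+1)`, the polynomial is odd
under `θ ↦ 1 - θ` for even `k`, and its Fourier series is the sine series. -/
lemma hurwitzZeta_sub_eq_tsum_sin (k : ℕ) (hk : 2 ≤ k) (hk_even : Even k) {θ : ℝ} (hθ0 : 0 < θ)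
    (hθ1 : θ < 1) :
    (-1 : ℂ) ^ (k / 2) * 2 ^ k * (Real.pi : ℂ) ^ (k + 1) / 4 *
      (HurwitzZeta.hurwitzZeta (θ : UnitAddCircle) (-(k : ℂ)) -
        HurwitzZeta.hurwitzZeta ((1 - θ : ℝ) : UnitAddCircle) (-(k : ℂ))) =
    k.factorial / 2 *
      ∑' m : ℕ+, (Real.sin (2 * Real.pi * m * θ) : ℂ) / (m : ℂ) ^ (k + 1) := by
  have hB : ∀ x : ℝ, ((Polynomial.bernoulli (k + 1)).map (algebraMap ℚ ℂ)).eval (x : ℂ) =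
      (bernoulliFun (k + 1) x : ℂ) := fun x => by
    rw [bernoulliFun, Polynomial.eval_map_algebraMap, Polynomial.eval_map_algebraMap]
    exact Polynomial.aeval_algebraMap_apply ℂ x _
  have h1 : bernoulliFun (k + 1) (1 - θ) = -bernoulliFun (k + 1) θ := by
    rw [bernoulliFun_eval_one_sub, hk_even.add_one.neg_one_pow]; ring
  rw [HurwitzZeta.hurwitzZeta_neg_nat (by omega) ⟨hθ0.le, hθ1.le⟩,
    HurwitzZeta.hurwitzZeta_neg_nat (by omega) ⟨by linarith, by linarith⟩, hB, hB, h1]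
  obtain ⟨l, hl⟩ := hk_even
  have hl2 : k = 2 * l := by omega
  have hS := hasSum_one_div_nat_pow_mul_sin (k := l) (by omega) (x := θ) ⟨hθ0.le, hθ1.le⟩
  have hS' : ∑' m : ℕ+, (Real.sin (2 * Real.pi * m * θ) : ℂ) / (m : ℂ) ^ (k + 1) =
      (((-1 : ℝ) ^ (l + 1) * (2 * Real.pi) ^ (k + 1) / 2 / (k + 1).factorial *
        bernoulliFun (k + 1) θ : ℝ) : ℂ) := by
    have h2 := hS.tsum_eq
    rw [← tsum_pnat_eq_tsum_of_eq_zero (f := fun n : ℕ => 1 / (n : ℝ) ^ (2 * l + 1) *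
      Real.sin (2 * Real.pi * n * θ)) (by simp)] at h2
    rw [hl2, bernoulliFun, ← h2, ofReal_tsum]
    refine tsum_congr fun m => ?_
    push_cast
    ring
  rw [hS', show k / 2 = l by omega, Nat.factorial_succ]
  have hf : (k.factorial : ℂ) ≠ 0 := by exact_mod_cast k.factorial_ne_zero
  have hk1 : (k : ℂ) + 1 ≠ 0 := by exact_mod_cast k.succ_ne_zero
  push_cast
  rw [mul_pow, pow_succ (-1 : ℂ) l, pow_succ (2 : ℂ) k]
  field_simp
  ring

lemma rationalTerm_eq (k : ℕ) (ν : ℂ) (a x : ℝ) (r : ℕ) (u : ℝ) :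
    rationalTerm k ν a x r u =
      (u : ℂ) ^ k / ((1 + 16 * Real.pi ^ 2 / (a ^ 2 * x) * r * u : ℝ) : ℂ) ^ (1 + ν + k) := by
  rw [rationalTerm, show 16 * Real.pi ^ 2 * r / (a ^ 2 * x) * u =
    16 * Real.pi ^ 2 / (a ^ 2 * x) * r * u by ring]

lemma summable_rationalTerm (k : ℕ) {ν : ℂ} (hν : 0 < ν.re) {a x α : ℝ} (ha : 0 < a) (hx : 0 < x)
    (hα : 0 < α) : Summable fun p : ℕ+ × ℕ => rationalTerm k ν a x p.1 (p.2 + α) := by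
  simp only [rationalTerm_eq]
  exact summable_rational k hν (by positivity) hα

theorem sineBesselIdentity (k : ℕ) (hk : 2 ≤ k) (hk_even : Even k) {ν : ℂ} (hν : 0 < ν.re)
    {a x : ℝ} (ha : 0 < a) (hx : 0 < x) {θ : ℝ} (hθ0 : 0 < θ) (hθ1 : θ < 1) :
    SineBesselIdentity k ν a x θ := by
  have hc : 0 < a ^ 2 * x / 4 := by positivity
  have hθ' : 0 < 1 - θ := by linarith
  have hs1 := summable_rationalTerm k hν ha hx hθ0
  have hs2 := summable_rationalTerm k hν ha hx hθ'
  have hs : Summable (fun p : ℕ+ × ℕ =>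
      rationalTerm k ν a x p.1 (p.2 + θ) - rationalTerm k ν a x p.1 (p.2 + 1 - θ)) := by
    simp only [add_sub_assoc]
    exact hs1.sub hs2
  refine ⟨?_, hs, ?_⟩
  · simp only [sineBesselTerm_eq k ν ha hx]
    exact (hasSum_sinDivisorSum_mul_besselKMellin k hν hc θ).summable.mul_left _
  · rw [mul_right_comm, hurwitzZeta_sub_eq_tsum_sin k hk hk_even hθ0 hθ1, ← hs.tsum_prod]
    simp only [sineBesselTerm_eq k ν ha hx, add_sub_assoc]
    rw [hs1.tsum_sub hs2, tsum_mul_left]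
    have hmain := tsum_sinDivisorSum_mul_besselKMellin k hk hk_even hν hc hθ0 hθ1
    have hb : 4 * Real.pi ^ 2 / (a ^ 2 * x / 4) = 16 * Real.pi ^ 2 / (a ^ 2 * x) := by
      field_simp; norm_num
    rw [hb] at hmain
    simp only [rationalTerm_eq]
    have hc0 : ((a ^ 2 * x / 4 : ℝ) : ℂ) ≠ 0 := by exact_mod_cast hc.ne'
    have hpow : ((a ^ 2 * x / 4 : ℝ) : ℂ) ^ (ν / 2 + k + 1) *
        ((a ^ 2 * x / 4 : ℝ) : ℂ) ^ (-(ν / 2)) = ((a ^ 2 * x / 4 : ℝ) : ℂ) ^ (k + 1) := by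
      rw [← cpow_add _ _ hc0, ← cpow_natCast]
      congr 1
      push_cast
      ring
    linear_combination hmain + (1 / 2 * ∑' n : ℕ+, (sinDivisorSum k θ n : ℂ) *
      besselKMellin ν (a ^ 2 * x / 4 * n)) * hpow

/-! ### Averaging over residues against an odd primitive character -/

section Characters

variable {q : ℕ} {χ : DirichletCharacter ℂ q}

lemma DirichletCharacter.Odd.inv (hodd : χ.Odd) : χ⁻¹.Odd := by
  have h := MulChar.star_apply' χ (-1)
  rw [show χ (-1) = -1 from hodd] at h
  rw [DirichletCharacter.Odd, ← h]
  simp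

/-- Oddness excludes `q = 1`, the only modulus with `χ 0 ≠ 0`. It removes the residue `h = 0`, for
which `θ = h/q` would leave `(0,1)`. -/
lemma DirichletCharacter.Odd.apply_zero [NeZero q] (hodd : χ.Odd) : χ 0 = 0 := by
  have hq : q ≠ 1 := by
    rintro rfl
    have h : χ (-1) = -1 := hodd
    rw [Subsingleton.elim (-1 : ZMod 1) 1, map_one] at h
    norm_num at h
  have : Fact (1 < q) := ⟨by have := NeZero.ne q; omega⟩
  exact MulChar.map_nonunit χ not_isUnit_zero

lemma DirichletCharacter.IsPrimitive.inv (hprim : χ.IsPrimitive) : χ⁻¹.IsPrimitive := by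
  rw [DirichletCharacter.isPrimitive_def, DirichletCharacter.conductor_inv]
  exact hprim

/-- The product of the Gauss sums of an odd primitive character and its inverse is `-q`. -/
lemma gaussSum_mul_gaussSum_inv_of_odd [NeZero q] (hodd : χ.Odd) (hprim : χ.IsPrimitive) :
    gaussSum χ ZMod.stdAddChar * gaussSum χ⁻¹ ZMod.stdAddChar = -(q : ℂ) := by
  have h1 : ZMod.dft (χ : ZMod q → ℂ) = (-gaussSum χ ZMod.stdAddChar) • ⇑χ⁻¹ := by
    ext j
    rw [DirichletCharacter.IsPrimitive.fourierTransform_eq_inv_mul_gaussSum hprim,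
      hodd.inv.eval_neg, Pi.smul_apply, smul_eq_mul]
    ring
  -- Applying the discrete Fourier transform twice gives `q χ(-j)`; at `j = 1` this is `-q`.
  have h2 := congrFun (ZMod.dft_dft (χ : ZMod q → ℂ)) 1
  rw [h1, map_smul, Pi.smul_apply,
    DirichletCharacter.IsPrimitive.fourierTransform_eq_inv_mul_gaussSum hprim.inv, inv_inv,
    show χ (-1) = -1 from hodd, smul_eq_mul, smul_eq_mul] at h2
  linear_combination h2

/-- Primitivity makes the Gauss sum separate for every `m`, coprime to `q` or not; oddness makes the
two exponentials of the sine add up. -/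
lemma sum_inv_mul_sin [NeZero q] (hodd : χ.Odd) (hprim : χ.IsPrimitive) (m : ℕ) :
    ∑ h : ZMod q, χ⁻¹ h * (Real.sin (2 * Real.pi * m * (h.val / q)) : ℂ) =
      -I * gaussSum χ⁻¹ ZMod.stdAddChar * χ m := by
  have hg : ∀ a : ZMod q, ∑ h : ZMod q, χ⁻¹ h * ZMod.stdAddChar (a * h) =
      χ a * gaussSum χ⁻¹ ZMod.stdAddChar := fun a => by
    have := gaussSum_mulShift_of_isPrimitive (ZMod.stdAddChar (N := q)) hprim.inv a
    rwa [inv_inv] at this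
  have hexp : ∀ (a : ℤ) (h : ZMod q), ZMod.stdAddChar ((a : ZMod q) * h) =
      exp (2 * Real.pi * I * a * h.val / q) := fun a h => by
    have : (a : ZMod q) * h = ((a * h.val : ℤ) : ZMod q) := by simp
    rw [this, ZMod.stdAddChar_coe]
    push_cast
    ring_nf
  have hsin : ∀ h : ZMod q, χ⁻¹ h * (Real.sin (2 * Real.pi * m * (h.val / q)) : ℂ) =
      I / 2 * (χ⁻¹ h * ZMod.stdAddChar (((-m : ℤ) : ZMod q) * h)) -
        I / 2 * (χ⁻¹ h * ZMod.stdAddChar (((m : ℤ) : ZMod q) * h)) := fun h => by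
    rw [hexp, hexp, ofReal_sin, Complex.sin]
    push_cast
    ring_nf
  simp only [hsin]
  rw [Finset.sum_sub_distrib, ← Finset.mul_sum, ← Finset.mul_sum, hg, hg]
  push_cast
  rw [hodd.eval_neg]
  ring

lemma sum_inv_mul_sinDivisorSum [NeZero q] (hodd : χ.Odd) (hprim : χ.IsPrimitive) (k n : ℕ) :
    ∑ h : ZMod q, χ⁻¹ h * (sinDivisorSum k (h.val / q) n : ℂ) =
      -I * gaussSum χ⁻¹ ZMod.stdAddChar * twistedSigmaBar k χ n := by
  simp only [sinDivisorSum, ofReal_sum, Finset.mul_sum, twistedSigmaBar]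
  rw [Finset.sum_comm]
  refine Finset.sum_congr rfl fun d hd => ?_
  have hd0 : (d : ℝ) ≠ 0 := by
    have := Nat.pos_of_mem_divisors hd
    positivity
  have h1 : ((n / d : ℕ) : ℝ) = n / d := Nat.cast_div (Nat.dvd_of_mem_divisors hd) hd0
  have h := sum_inv_mul_sin hodd hprim (n / d)
  rw [mul_left_comm, ← h, Finset.mul_sum]
  refine Finset.sum_congr rfl fun j _ => ?_
  rw [h1, show 2 * Real.pi * n * (j.val / q) / d = 2 * Real.pi * (n / d) * (j.val / q) by ring]
  push_cast
  ring

lemma val_div_pos_lt_one [NeZero q] {h : ZMod q} (hh : h ≠ 0) :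
    0 < (h.val / q : ℝ) ∧ (h.val / q : ℝ) < 1 := by
  have hq : (0 : ℝ) < q := by exact_mod_cast NeZero.pos q
  have h1 : 0 < h.val := Nat.pos_of_ne_zero ((ZMod.val_ne_zero h).2 hh)
  have h2 : h.val < q := ZMod.val_lt h
  refine ⟨by positivity, (div_lt_one hq).2 (by exact_mod_cast h2)⟩

lemma val_neg_div [NeZero q] {h : ZMod q} (hh : h ≠ 0) : ((-h).val / q : ℝ) = 1 - h.val / q := by
  have : NeZero h := ⟨hh⟩
  have hq : (q : ℝ) ≠ 0 := by exact_mod_cast NeZero.ne q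
  rw [ZMod.val_neg_of_ne_zero, Nat.cast_sub (ZMod.val_lt h).le, sub_div, div_self hq]

/-- The rational terms at `N / q`, as a function of the pair `(N, r)`. -/
lemma rationalTerm_div (k : ℕ) (ν : ℂ) (a x : ℝ) (r N : ℕ) :
    rationalTerm k ν a x r (N / q) = 1 / (q : ℂ) ^ k *
      ((N : ℂ) ^ k / ((16 * Real.pi ^ 2 / (a ^ 2 * q) * ((N * r : ℝ) / x) + 1 : ℝ) : ℂ) ^
        (ν + k + 1)) := by
  rw [rationalTerm, show 1 + 16 * Real.pi ^ 2 * r / (a ^ 2 * x) * (N / q) =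
    16 * Real.pi ^ 2 / (a ^ 2 * q) * ((N * r : ℝ) / x) + 1 by
      rw [mul_comm (a ^ 2) (q : ℝ), mul_comm (a ^ 2) x]
      simp only [div_eq_mul_inv, mul_inv]
      ring, show 1 + ν + k = ν + k + 1 by ring]
  push_cast
  rw [div_pow]
  ring

lemma summable_inv_mul_rationalTerm [NeZero q] (k : ℕ) {ν : ℂ} (hν : 0 < ν.re) {a x : ℝ} (ha : 0 < a)
    (hx : 0 < x) : Summable fun p : ℕ+ × ℕ+ =>
      χ⁻¹ (p.2 : ℕ) * rationalTerm k ν a x p.1 (p.2 / q) := by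
  have hq : (0 : ℝ) < q := by exact_mod_cast NeZero.pos q
  have h1 : Summable fun p : ℕ+ × ℕ+ => 1 / (16 * Real.pi ^ 2 / (a ^ 2 * x)) ^ (1 + ν.re + k) *
      (1 / (p.1 : ℝ) ^ (1 + ν.re + k) * (1 / (p.2 / q : ℝ) ^ (1 + ν.re))) := by
    have ha : Summable fun n : ℕ+ => 1 / (n : ℝ) ^ (1 + ν.re + k) :=
      (Real.summable_one_div_nat_rpow.2 (by linarith [k.cast_nonneg (α := ℝ)])).comp_injective
        PNat.coe_injective
    have hb : Summable fun n : ℕ+ => 1 / (n / q : ℝ) ^ (1 + ν.re) := by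
      have h := ((Real.summable_one_div_nat_rpow.2
        (by linarith : 1 < 1 + ν.re)).comp_injective PNat.coe_injective).mul_left
          ((q : ℝ) ^ (1 + ν.re))
      refine h.congr fun n => ?_
      rw [Real.div_rpow (by positivity) hq.le, one_div_div, Function.comp_apply]
      ring
    exact (ha.mul_of_nonneg hb (fun _ => by positivity) (fun _ => by positivity)).mul_left _
  refine h1.of_norm_bounded fun p => ?_
  rw [norm_mul, rationalTerm_eq]
  refine (mul_le_of_le_one_left (norm_nonneg _) (DirichletCharacter.norm_le_one _ _)).trans ?_
  have hN : (0 : ℝ) < p.2 := by exact_mod_cast p.2.pos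
  exact norm_rational_le k hν (by positivity) (by exact_mod_cast p.1.pos) (by positivity)

/-- Every `N` is uniquely `h + qm`, so `m + h/q = N/q` and the shifted sums merge into one sum over
`N`. -/
lemma sum_inv_mul_tsum_rationalTerm [NeZero q] (hodd : χ.Odd) (k : ℕ) {ν : ℂ} (hν : 0 < ν.re) {a x : ℝ}
    (ha : 0 < a) (hx : 0 < x) :
    ∑ h : ZMod q, χ⁻¹ h * ∑' p : ℕ+ × ℕ, rationalTerm k ν a x p.1 (p.2 + h.val / q) =
      ∑' p : ℕ+ × ℕ+, χ⁻¹ (p.2 : ℕ) * rationalTerm k ν a x p.1 (p.2 / q) := by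
  have hq : (q : ℝ) ≠ 0 := by exact_mod_cast NeZero.ne q
  have hs := summable_inv_mul_rationalTerm (χ := χ) k hν ha hx
  have hz : χ⁻¹ 0 = 0 := hodd.inv.apply_zero
  have hD : ∀ h : ZMod q, Summable fun p : ℕ+ × ℕ =>
      χ⁻¹ h * rationalTerm k ν a x p.1 (p.2 + h.val / q) := fun h => by
    by_cases hh : h = 0
    · simp only [hh, hz, zero_mul]
      exact summable_zero
    · exact (summable_rationalTerm k hν ha hx (val_div_pos_lt_one hh).1).mul_left _
  simp only [← tsum_mul_left]
  rw [hs.tsum_prod]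
  have h1 : ∀ h : ZMod q, ∑' p : ℕ+ × ℕ, χ⁻¹ h * rationalTerm k ν a x p.1 (p.2 + h.val / q) =
      ∑' r : ℕ+, ∑' m : ℕ, χ⁻¹ h * rationalTerm k ν a x r (m + h.val / q) := fun h =>
    (hD h).tsum_prod
  simp only [h1]
  rw [← Summable.tsum_finsetSum fun h _ => (hD h).prod]
  refine tsum_congr fun r => ?_
  have hsr : Summable fun N : ℕ => χ⁻¹ (N : ZMod q) * rationalTerm k ν a x r (N / q) :=
    summable_pnat_iff_summable_nat.1 (hs.prod_factor r)
  rw [tsum_pnat_eq_tsum_of_eq_zero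
    (f := fun N : ℕ => χ⁻¹ (N : ZMod q) * rationalTerm k ν a x r (N / q)) (by simp [hz]),
    Nat.sumByResidueClasses hsr q]
  refine Finset.sum_congr rfl fun h _ => tsum_congr fun m => ?_
  have e1 : (m : ℝ) + h.val / q = ((h.val + q * m : ℕ) : ℝ) / q := by
    push_cast
    field_simp
    ring
  rw [e1]
  simp

/-- At `N/q` the denominator depends only on the product `Nr`, so the double sum regroups by `n =
Nr`, with `d = N`. -/
lemma hasSum_twistedSigmaConj [NeZero q] (k : ℕ) {ν : ℂ} (hν : 0 < ν.re) {a x : ℝ} (ha : 0 < a)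
    (hx : 0 < x) :
    HasSum (fun n : ℕ+ => 1 / (q : ℂ) ^ k * (twistedSigmaConj k χ n *
      (1 / ((16 * Real.pi ^ 2 / (a ^ 2 * q) * (n / x) + 1 : ℝ) : ℂ) ^ (ν + k + 1))))
      (∑' p : ℕ+ × ℕ+, χ⁻¹ (p.2 : ℕ) * rationalTerm k ν a x p.1 (p.2 / q)) := by
  let F : ℕ → ℕ → ℂ := fun N r => χ⁻¹ (N : ZMod q) * rationalTerm k ν a x r (N / q)
  have hs := (Equiv.prodComm ℕ+ ℕ+).summable_iff.2
    (summable_inv_mul_rationalTerm (χ := χ) k hν ha hx)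
  have h := hasSum_sum_divisors (F := F) hs
  have ht : ∑' p : ℕ+ × ℕ+, F p.1 p.2 =
      ∑' p : ℕ+ × ℕ+, χ⁻¹ (p.2 : ℕ) * rationalTerm k ν a x p.1 (p.2 / q) :=
    (Equiv.prodComm ℕ+ ℕ+).tsum_eq
      (fun p : ℕ+ × ℕ+ => χ⁻¹ (p.2 : ℕ) * rationalTerm k ν a x p.1 (p.2 / q))
  rw [ht] at h
  refine h.congr_fun fun n => ?_
  rw [twistedSigmaConj, Finset.sum_mul, Finset.mul_sum]
  refine Finset.sum_congr rfl fun d hd => ?_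
  have hdn : ((d : ℝ) * (n / d : ℕ)) = (n : ℕ) := by
    exact_mod_cast Nat.mul_div_cancel' (Nat.dvd_of_mem_divisors hd)
  simp only [F]
  rw [rationalTerm_div, hdn, ← MulChar.star_apply', starRingEnd_apply]
  ring

end Characters

/-- Averaging the sine identities at `θ = h / q` against `χ⁻¹(h)` gives the character identity. -/
theorem characterBesselIdentity_of_sine (k : ℕ) (hk : 2 ≤ k) (hk_even : Even k) {ν : ℂ}
    (hν : 0 < ν.re) {a x : ℝ} (ha : 0 < a) (hx : 0 < x)
    (hsine : ∀ θ : ℝ, 0 < θ → θ < 1 → SineBesselIdentity k ν a x θ) {q : ℕ} [NeZero q]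
    (χ : DirichletCharacter ℂ q) (hodd : χ.Odd) (hprim : χ.IsPrimitive) :
    CharacterBesselIdentity k ν a x χ := by
  have hq0 : (q : ℂ) ≠ 0 := by exact_mod_cast NeZero.ne q
  have hz : χ⁻¹ 0 = 0 := hodd.inv.apply_zero
  set τ := gaussSum χ (ZMod.stdAddChar (N := q))
  set τ' := gaussSum χ⁻¹ (ZMod.stdAddChar (N := q))
  have hττ : τ * τ' = -(q : ℂ) := gaussSum_mul_gaussSum_inv_of_odd hodd hprim
  have hτ'0 : τ' ≠ 0 := fun h => hq0 (by rw [h, mul_zero] at hττ; linear_combination hττ)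
  have hIτ : -I * τ' ≠ 0 := mul_ne_zero (neg_ne_zero.2 I_ne_zero) hτ'0
  -- the Bessel series
  have hBs : ∀ h : ZMod q, Summable fun n : ℕ+ => χ⁻¹ h * sineBesselTerm k ν a x (h.val / q) n :=
    fun h => by
      by_cases hh : h = 0
      · simp only [hh, hz, zero_mul]
        exact summable_zero
      · exact (hsine _ (val_div_pos_lt_one hh).1 (val_div_pos_lt_one hh).2).1.mul_left _
  have hBterm : ∀ n : ℕ+, ∑ h : ZMod q, χ⁻¹ h * sineBesselTerm k ν a x (h.val / q) n =
      -I * τ' * (twistedSigmaBar k χ n * (n : ℂ) ^ (ν / 2) *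
        besselK ν ((a * Real.sqrt (n * x) : ℝ) : ℂ)) := fun n => by
    have h1 := sum_inv_mul_sinDivisorSum hodd hprim k n
    simp only [sineBesselTerm, mul_left_comm (χ⁻¹ _)]
    rw [← Finset.mul_sum, h1]
    ring
  have hB := hasSum_sum (s := Finset.univ) fun h _ => (hBs h).hasSum
  simp only [hBterm] at hB
  have hBsum : Summable fun n : ℕ+ => twistedSigmaBar k χ n * (n : ℂ) ^ (ν / 2) *
      besselK ν ((a * Real.sqrt (n * x) : ℝ) : ℂ) := (summable_mul_left_iff hIτ).1 hB.summable
  have hBeq := hB.tsum_eq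
  rw [tsum_mul_left] at hBeq
  -- the Dirichlet series
  have hLs : ∀ h : ZMod q, Summable fun m : ℕ+ =>
      χ⁻¹ h * ((Real.sin (2 * Real.pi * m * (h.val / q)) : ℂ) / (m : ℂ) ^ (k + 1)) := fun h =>
    (summable_sin_div_pow k hk _).mul_left _
  have hLterm : ∀ m : ℕ+, ∑ h : ZMod q,
      χ⁻¹ h * ((Real.sin (2 * Real.pi * m * (h.val / q)) : ℂ) / (m : ℂ) ^ (k + 1)) =
      -I * τ' * (χ (m : ℕ) / (m : ℂ) ^ (k + 1)) := fun m => by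
    have h1 := sum_inv_mul_sin hodd hprim m
    rw [← mul_div_assoc, ← h1, Finset.sum_div]
    exact Finset.sum_congr rfl fun h _ => (mul_div_assoc _ _ _).symm
  have hLeq := (hasSum_sum (s := Finset.univ) fun h _ => (hLs h).hasSum).tsum_eq
  simp only [hLterm] at hLeq
  have hLval : ∑' m : ℕ+, χ (m : ℕ) / (m : ℂ) ^ (k + 1) =
      DirichletCharacter.LFunction χ (1 + (k : ℂ)) := by
    rw [DirichletCharacter.LFunction_eq_LSeries χ (by simp; omega), LSeries,
      ← tsum_pnat_eq_tsum_of_eq_zero (by simp)]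
    refine tsum_congr fun m => ?_
    rw [LSeries.term_of_ne_zero m.ne_zero, ← cpow_natCast]
    push_cast
    rw [add_comm (k : ℂ)]
  rw [tsum_mul_left, hLval] at hLeq
  -- the rational series
  let D : ℝ → ℂ := fun α => ∑' p : ℕ+ × ℕ, rationalTerm k ν a x p.1 (p.2 + α)
  have hDsub : ∀ h : ZMod q, χ⁻¹ h * ∑' r : ℕ+, ∑' m : ℕ,
      (rationalTerm k ν a x r (m + h.val / q) - rationalTerm k ν a x r (m + 1 - h.val / q)) =
      χ⁻¹ h * D (h.val / q) - χ⁻¹ h * D ((-h).val / q) := fun h => by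
    by_cases hh : h = 0
    · simp [hh, hz]
    · have h1 := summable_rationalTerm k hν ha hx (val_div_pos_lt_one hh).1
      have h2 := summable_rationalTerm k hν ha hx (val_div_pos_lt_one (neg_ne_zero.2 hh)).1
      rw [← mul_sub, ← h1.tsum_sub h2, (h1.sub h2).tsum_prod, val_neg_div hh]
      simp only [add_sub_assoc]
  -- The `1 - θ` half at `h` is the `θ` half at `-h`; oddness makes the two equal after averaging,
  -- turning the coefficient `1/4` into `1/2`.
  have hDneg : ∑ h : ZMod q, χ⁻¹ h * D ((-h).val / q) = -∑ h : ZMod q, χ⁻¹ h * D (h.val / q) := by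
    rw [← Equiv.sum_comp (Equiv.neg (ZMod q)), ← Finset.sum_neg_distrib]
    refine Finset.sum_congr rfl fun h _ => ?_
    simp only [Equiv.neg_apply, neg_neg, hodd.inv.eval_neg]
    ring
  have hR := hasSum_twistedSigmaConj (χ := χ) k hν ha hx
  rw [← sum_inv_mul_tsum_rationalTerm hodd k hν ha hx] at hR
  have hRs : Summable fun n : ℕ+ => twistedSigmaConj k χ n *
      (1 / ((16 * Real.pi ^ 2 / (a ^ 2 * q) * (n / x) + 1 : ℝ) : ℂ) ^ (ν + k + 1)) :=
    (summable_mul_left_iff (one_div_ne_zero (pow_ne_zero k hq0))).1 hR.summable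
  have hReq := hR.tsum_eq
  rw [tsum_mul_left] at hReq
  have hΓ : ∀ n : ℕ+, twistedSigmaConj k χ n * (Gamma (ν + k + 1) /
      ((16 * Real.pi ^ 2 / (a ^ 2 * q) * (n / x) + 1 : ℝ) : ℂ) ^ (ν + k + 1)) =
      Gamma (ν + k + 1) * (twistedSigmaConj k χ n *
      (1 / ((16 * Real.pi ^ 2 / (a ^ 2 * q) * (n / x) + 1 : ℝ) : ℂ) ^ (ν + k + 1))) := fun n => by
    ring
  refine ⟨hBsum, ?_, ?_⟩
  · simp only [hΓ]
    exact hRs.mul_left _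
  simp only [hΓ]
  rw [tsum_mul_left]
  -- sum the sine identities
  have hkey : ∀ h : ZMod q, ((a ^ 2 * x / 4 : ℝ) : ℂ) ^ (ν / 2 + k + 1) *
      ∑' n : ℕ+, χ⁻¹ h * sineBesselTerm k ν a x (h.val / q) n =
      k.factorial / 2 * Gamma (ν + k + 1) * ∑' m : ℕ+,
        χ⁻¹ h * ((Real.sin (2 * Real.pi * m * (h.val / q)) : ℂ) / (m : ℂ) ^ (k + 1)) +
      (-1 : ℂ) ^ (k / 2) / 4 * (2 * (Real.pi : ℂ)) ^ (k + 1) * Gamma (ν + k + 1) *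
        (χ⁻¹ h * D (h.val / q) - χ⁻¹ h * D ((-h).val / q)) := fun h => by
    rw [← hDsub, tsum_mul_left, tsum_mul_left]
    by_cases hh : h = 0
    · simp [hh, hz]
    · have h0 := (val_div_pos_lt_one hh).1
      have h1 := (val_div_pos_lt_one hh).2
      have h2 := (hsine _ h0 h1).2.2
      rw [mul_right_comm, hurwitzZeta_sub_eq_tsum_sin k hk hk_even h0 h1] at h2
      linear_combination χ⁻¹ h * h2
  have htotal := Finset.sum_congr (rfl : (Finset.univ : Finset (ZMod q)) = _)
    fun h _ => hkey h
  rw [← Finset.mul_sum, Finset.sum_add_distrib, ← Finset.mul_sum, ← Finset.mul_sum,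
    Finset.sum_sub_distrib, hDneg, ← hBeq, ← hLeq, ← hReq] at htotal
  -- Every averaged Bessel and Dirichlet term carries the factor `-iτ(χ⁻¹)`; on the rational side,
  -- `τ(χ) τ(χ⁻¹) = -q` restores it and supplies the last power of `q`.
  refine mul_left_cancel₀ hIτ ?_
  have hq2 : (2 * (Real.pi : ℂ) / q) ^ (k + 1) * q = (2 * Real.pi) ^ (k + 1) / (q : ℂ) ^ k := by
    rw [div_pow, pow_succ (q : ℂ)]
    field_simp
  generalize ∑' n : ℕ+, twistedSigmaConj k χ n *
      (1 / ((16 * Real.pi ^ 2 / (a ^ 2 * q) * (n / x) + 1 : ℝ) : ℂ) ^ (ν + k + 1)) = R at *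
  set A : ℂ := (-1 : ℂ) ^ (k / 2) / 2 * Gamma (ν + k + 1) * R
  linear_combination htotal - A * hq2 - τ * τ' * A * (2 * (Real.pi : ℂ) / q) ^ (k + 1) * I_sq +
    A * (2 * (Real.pi : ℂ) / q) ^ (k + 1) * hττ

theorem theorem2p3 (k : ℕ) (hk : 2 ≤ k) (hk_even : Even k) (ν : ℂ) (hν : 0 < ν.re)
    (a x : ℝ) (ha : 0 < a) (hx : 0 < x) :
    (∀ θ : ℝ, 0 < θ → θ < 1 → SineBesselIdentity k ν a x θ) ∧
    ((∀ θ : ℝ, 0 < θ → θ < 1 → SineBesselIdentity k ν a x θ) ↔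
      (∀ (q : ℕ) [NeZero q] (χ : DirichletCharacter ℂ q), χ.Odd → χ.IsPrimitive →
        CharacterBesselIdentity k ν a x χ)) := by
  have h : ∀ θ : ℝ, 0 < θ → θ < 1 → SineBesselIdentity k ν a x θ := fun θ hθ0 hθ1 =>
    sineBesselIdentity k hk hk_even hν ha hx hθ0 hθ1
  -- The reverse implication returns the sine identity already proved, without inverting the
  -- average.
  exact ⟨h, fun hs q _ χ hodd hprim =>
    characterBesselIdentity_of_sine k hk hk_even hν ha hx hs χ hodd hprim, fun _ => h⟩
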